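/- **Setting.** All graphs are finite and simple. A *locally checkable labeling (LCL) problem* is a tuple $\Pi=(\Sigma_{\mathrm{in}},\Sigma_{\mathrm{out}},C,r)$, where $\Sigma_{\mathrm{in}},\Sigma_{\mathrm{out}}$ are finite sets, $r\ge 1$ is an integer, and $C$ is a finite set of finite graphs $H$, each with a distinguished centre of eccentricity at most $r$, whose edge-endpoint pairs $(uv,v)$ each carry a label from $\Sigma_{\mathrm{in}}$ and a label from $\Sigma_{\mathrm{out}}$. An input of $\Pi$ is a graph $G$ whose edge-endpoint pairs are labeled from $\Sigma_{\mathrm{in}}$; a *solution* on $G$ is a labeling of its edge-endpoint pairs from $\Sigma_{\mathrm{out}}$ such that, for each node $v$, the labeled graph formed by the nodes at distance at most $r$ from $v$ and the edges with at least one endpoint at distance at most $r-1$ from $v$ is isomorphic to some member of $C$, by an isomorphism that preserves both labels and maps $v$ to the centre. A family $\mathcal G$ of graphs is of *sub-exponential growth* if for every $c>0$ there is $x_0$ such that $|N_{\le x}(v)|\le 2^{cx}$ for all integers $x\ge x_0$, all $G\in\mathcal G$ and all nodes $v$ of $G$, where $N_{\le x}(v)$ is the set of nodes at distance at most $x$ from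 $v$. Algorithms are deterministic algorithms in the LOCAL model: each node has a unique identifier (an arbitrary natural number) and an arbitrary numbering of its incident edges (ports), and initially knows its identifier, its degree, the number of nodes and the maximum degree of the graph, the input labels at its ports, and its advice string; in each synchronous round it exchanges messages of arbitrary size with its neighbors and performs arbitrary local computation. It finally outputs a label from $\Sigma_{\mathrm{out}}$ for each of its ports. For a family $\mathcal G$ of $\Sigma_{\mathrm{in}}$-labeled graphs and an integer $T$, a *uniform fixed-length $\varepsilon$-sparse $(\mathcal G,\Pi,1,T)$-advice schema* is a function that assigns to each $G\in\mathcal G$ with unique identifiers exactly one bit per node, such that the fraction of nodes of $G$ that receive the bit $1$ is at most $\varepsilon$, and such that there is a single LOCAL algorithm that, on every $G\in\mathcal G$ with any unique identifiers and any port numbering, given these bits as advice, runs in at most $T$ rounds and outputs a solution of $\Pi$ on $G$. **Theorem.** Let $\Pi$ be an LCL problem, let $\Delta$ be a natural number, and let $\mathcal G$ be a family of $\Sigma_{\mathrm{in}}$-labeled graphs of maximum degree at most $\Delta$ that is of sub-exponential growth and such that $\Pi$ has a solution on every $G\in\mathcal G$. Then there is a uniform fixed-length sparse $(\mathcal G,\Pi,1,O(1))$-advice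 schema. That is, for every $\varepsilon>0$ there is a constant $T(\varepsilon)$, depending only on $\varepsilon$, $\Pi$ and $\mathcal G$, such that there is a uniform fixed-length $\varepsilon$-sparse $(\mathcal G,\Pi,1,T(\varepsilon))$-advice schema. -/

import Mathlib

namespace LocalAdvice

/-- A finite simple graph in which every edge-endpoint pair carries a label from `L`:
`label u v h` is the label of the pair `(uv, u)`. -/
structure LGraph (L : Type) : Type 1 where
  V : Type
  [fintypeV : Fintype V]
  graph : SimpleGraph V
  label : ∀ u v : V, graph.Adj u v → L

attribute [instance] LGraph.fintypeV

namespace LGraph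

variable {L : Type}

open scoped Classical in
/-- The degree of a node. -/
noncomputable def deg (G : LGraph L) (v : G.V) : ℕ := G.graph.degree v

open scoped Classical in
/-- The maximum degree of the graph (`0` for the empty graph). -/
noncomputable def maxDeg (G : LGraph L) : ℕ := G.graph.maxDegree

/-- `N_{≤ d}(v)`: the nodes at distance at most `d` from `v`. The distance is `⊤` between
different connected components. -/
def nbhd (G : LGraph L) (v : G.V) (d : ℕ) : Set G.V := {u | G.graph.edist v u ≤ (d : ℕ∞)}

/-- The radius-`r` neighbourhood of `v`: the nodes at distance at most `r` from `v`, the edges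
with at least one endpoint at distance at most `r - 1` (that is, less than `r`) from `v`, and the
labels of these edges at both endpoints. -/
noncomputable def ball (G : LGraph L) (v : G.V) (r : ℕ) : LGraph L where
  V := G.nbhd v r
  fintypeV := Fintype.ofFinite _
  graph :=
    { Adj := fun a b => G.graph.Adj a b ∧
        (G.graph.edist v a < (r : ℕ∞) ∨ G.graph.edist v b < (r : ℕ∞))
      symm := ⟨fun _ _ h => ⟨h.1.symm, h.2.symm⟩⟩
      loopless := ⟨fun _ h => G.graph.loopless.irrefl _ h.1⟩ }
  label := fun a b h => G.label a b h.1

/-- `v` as a node of its own radius-`r` neighbourhood. -/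
def ballRoot (G : LGraph L) (v : G.V) (r : ℕ) : (G.ball v r).V :=
  ⟨v, by simp [nbhd]⟩

/-- The graph `G`, labelled with pairs: its own label and a second label `ℓ`. -/
abbrev pairLabel {L' : Type} (G : LGraph L) (ℓ : ∀ u v : G.V, G.graph.Adj u v → L') :
    LGraph (L × L') where
  V := G.V
  graph := G.graph
  label := fun u v h => (G.label u v h, ℓ u v h)

end LGraph

/-- A labelled graph with a distinguished node (the centre of a neighbourhood). -/
structure RootedLGraph (L : Type) : Type 1 extends LGraph L where
  root : V

/-- There is an isomorphism of graphs from `G` to `H` that preserves the labels and maps the node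
`v` of `G` to the root of `H`. -/
def RootedIso {L : Type} (G : LGraph L) (v : G.V) (H : RootedLGraph L) : Prop :=
  ∃ φ : G.graph ≃g H.graph, φ v = H.root ∧
    ∀ (a b : G.V) (h : G.graph.Adj a b), H.label (φ a) (φ b) (φ.map_rel_iff.2 h) = G.label a b h

/-- A locally checkable labelling problem `(Σ_in, Σ_out, C, r)`; the label sets `In` and `Out` are
assumed to be finite where the notion is used. The neighbourhoods in `C` are rooted at a node of
eccentricity at most `r`. A constraint set of unrooted graphs is the special case in which `C`
contains each of its graphs with all choices of a root of eccentricity at most `r`. -/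
structure LCL (In Out : Type) : Type 1 where
  /-- the checkability radius -/
  r : ℕ
  r_pos : 0 < r
  /-- the allowed labelled neighbourhoods -/
  C : Set (RootedLGraph (In × Out))
  C_finite : C.Finite
  ecc_le : ∀ H ∈ C, ∀ u : H.V, H.graph.edist H.root u ≤ (r : ℕ∞)

/-- The output labelling `ℓ` of the edge-endpoint pairs is a valid solution of the problem `P` on
the input-labelled graph `G`. -/
def LCL.IsSolution {In Out : Type} (P : LCL In Out) (G : LGraph In)
    (ℓ : ∀ u v : G.V, G.graph.Adj u v → Out) : Prop :=
  ∀ v : G.V, ∃ H ∈ P.C,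
    RootedIso ((G.pairLabel ℓ).ball v P.r) ((G.pairLabel ℓ).ballRoot v P.r) H

/-- Every node numbers its incident edges (ports) by `0, …, deg - 1`. -/
abbrev PortNumbering {In : Type} (G : LGraph In) : Type :=
  ∀ v : G.V, G.graph.neighborSet v ≃ Fin (G.deg v)

/-- A deterministic algorithm in the LOCAL model, with advice, for problems whose inputs and outputs
are labels on edge-endpoint pairs. Messages are of unbounded size and local computation is
unrestricted.
* `init n Δ id adv d inp` is the initial state of a node of degree `d` with identifier `id` and
  advice string `adv` in a graph with `n` nodes and maximum degree `Δ`, where `inp i` is the input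
  label of the node on its port `i`;
* `send s i` is the message that a node in state `s` sends through its port `i`;
* `receive s d m` is the next state of a node of degree `d` in state `s` that receives the message
  `m i` through its port `i`;
* `output s i` is the output label on port `i` of a node in state `s`, if there is one. -/
structure LocalAlgorithm (In Out : Type) : Type 1 where
  State : Type
  Msg : Type
  init : (n Δ id : ℕ) → (adv : List Bool) → (d : ℕ) → (inp : Fin d → In) → State
  send : State → ℕ → Msg
  receive : State → (d : ℕ) → (Fin d → Msg) → State
  output : State → ℕ → Option Out

namespace LocalAlgorithm

variable {In Out : Type}

/-- The state of each node after `t` synchronous rounds, on the graph `G` with identifiers `ident`,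
ports `p` and advice `adv`. -/
noncomputable def state (A : LocalAlgorithm In Out) (G : LGraph In) (ident : G.V ↪ ℕ)
    (p : PortNumbering G) (adv : G.V → List Bool) : ℕ → G.V → A.State
  | 0, v => A.init (Fintype.card G.V) G.maxDeg (ident v) (adv v) (G.deg v)
      (fun i => G.label v ((p v).symm i).1 ((p v).symm i).2)
  | t + 1, v => A.receive (A.state G ident p adv t v) (G.deg v)
      (fun i => A.send (A.state G ident p adv t ((p v).symm i).1)
        (p ((p v).symm i).1 ⟨v, ((p v).symm i).2.symm⟩).1)

/-- After `t` rounds every node has produced an output on each of its ports, and the labelling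
obtained is `ℓ`. -/
def Produces (A : LocalAlgorithm In Out) (G : LGraph In) (ident : G.V ↪ ℕ)
    (p : PortNumbering G) (adv : G.V → List Bool) (t : ℕ)
    (ℓ : ∀ u v : G.V, G.graph.Adj u v → Out) : Prop :=
  ∀ (u v : G.V) (h : G.graph.Adj u v),
    A.output (A.state G ident p adv t u) (p u ⟨v, h⟩).1 = some (ℓ u v h)

end LocalAlgorithm

/-- An assignment of bit-strings to the nodes of every input-labelled graph with unique
identifiers. -/
abbrev AdviceMap (In : Type) : Type 1 :=
  ∀ G : LGraph In, (G.V ↪ ℕ) → G.V → List Bool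

section Schemas

variable {In Out : Type}

/-- `f` is a `(𝒢, P, β, T)`-advice schema, where `β` and `T` are functions of the maximum degree:
the bit-strings have length at most `β`, and one LOCAL algorithm solves `P` in `T` rounds with this
advice on all graphs of `𝒢`, whatever the unique identifiers and the port numbering are. (An
algorithm that is done earlier stays idle until round `T`.) -/
def IsAdviceSchema (𝒢 : Set (LGraph In)) (P : LCL In Out) (β T : ℕ → ℕ) (f : AdviceMap In) :
    Prop :=
  (∀ G ∈ 𝒢, ∀ (ident : G.V ↪ ℕ) (v : G.V), (f G ident v).length ≤ β G.maxDeg) ∧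
  ∃ A : LocalAlgorithm In Out, ∀ G ∈ 𝒢, ∀ (ident : G.V ↪ ℕ) (p : PortNumbering G),
    ∃ ℓ : ∀ u v : G.V, G.graph.Adj u v → Out,
      P.IsSolution G ℓ ∧ A.Produces G ident p (f G ident) (T G.maxDeg) ℓ

/-- Uniform fixed-length: all nodes of a graph receive bit-strings of the same length. -/
def IsUniformFixedLength (𝒢 : Set (LGraph In)) (f : AdviceMap In) : Prop :=
  ∀ G ∈ 𝒢, ∀ (ident : G.V ↪ ℕ) (u v : G.V), (f G ident u).length = (f G ident v).length

/-- `ε`-sparse: each node receives exactly one bit, and the fraction of the nodes that receive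
a `1` is at most `ε` in every graph of `𝒢`. -/
def IsEpsSparse (𝒢 : Set (LGraph In)) (ε : ℝ) (f : AdviceMap In) : Prop :=
  ∀ G ∈ 𝒢, ∀ ident : G.V ↪ ℕ, (∀ v : G.V, (f G ident v).length = 1) ∧
    ({v : G.V | f G ident v = [true]}.ncard : ℝ) /
      (({v : G.V | f G ident v = [false]}.ncard : ℝ) +
        ({v : G.V | f G ident v = [true]}.ncard : ℝ)) ≤ ε

/-- There is a uniform fixed-length sparse `(𝒢, P, 1, T)`-advice schema, where `T` maps `ε` to a
function of the maximum degree: for every `ε > 0` there is a uniform fixed-length `ε`-sparse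
`(𝒢, P, 1, T ε)`-advice schema. -/
def HasUniformSparseSchema (𝒢 : Set (LGraph In)) (P : LCL In Out) (T : ℝ → ℕ → ℕ) : Prop :=
  ∀ ε : ℝ, 0 < ε → ∃ f : AdviceMap In,
    IsAdviceSchema 𝒢 P (fun _ => 1) (T ε) f ∧ IsUniformFixedLength 𝒢 f ∧ IsEpsSparse 𝒢 ε f

/-- The family `𝒢` has sub-exponential growth. -/
def SubexpGrowth (𝒢 : Set (LGraph In)) : Prop :=
  ∀ c : ℝ, 0 < c → ∃ x₀ : ℕ, ∀ x : ℕ, x₀ ≤ x → ∀ G ∈ 𝒢, ∀ v : G.V,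
    ((G.nbhd v x).ncard : ℝ) ≤ (2 : ℝ) ^ (c * (x : ℝ))

end Schemas

end LocalAdvice

/-! Fix `s ≥ 1/ε` and let `ρ = 2s(m+1)`. Take a maximal set `X` of centers at pairwise distance more
than `3ρ`, each having a node at distance exactly `ρ`. Nodes within `3ρ` of a center are divided
into tiles; any other node has its whole component within distance `3ρ`, and that component is
solved by brute force. Each center owns a geodesic of length `ρ`, on which at most `m + 3` ones
encode `m` bits (`exists_beacons`), so the ones have density at most `1/s`. By sub-exponential
growth, balls of radius `8ρ` have at most `D` nodes with `2D² ≤ 2^m` (`SubexpGrowth.exists_scale`),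
so these `m` bits hold two pointers to centers at distance at most `8ρ` and one free bit.

Tiles are grouped into cells. Ball growing in the graph of nearby centers, again by sub-exponential
growth, yields clusters of bounded radius whose boundary, when they are carved out, is an
arbitrarily small fraction of the cluster (`exists_carving_finset`). Following the first pointer `k`
times leads from a center to the leader of its cell. Once a solution is fixed near the cell
boundaries, the cells can be completed independently, since constraints have radius `r`
(`Plan.isSolution_out`). The labels in a boundary tile need boundedly many bits. The second pointer
names a host for the tile, such that no cell stores more bits than it has centers; so the free bits
suffice (`Plan.Realizes.exists_bit`).

All decoding happens within constant radius. `IsLocal` expresses this and is closed under the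
operations in use; `IsLocal.exists_algorithm` turns it into a LOCAL algorithm. Labellings are
functions of pairs of identifiers, so that they make sense independently of the surrounding graph.
-/

namespace LocalAdvice

/-! ### Views and the functions they determine -/

/-- A labelled graph with unique identifiers. -/
structure Net (In : Type) : Type 1 extends LGraph In where
  ident : V ↪ ℕ

/-- What a node can know after `t` rounds of the full-information protocol. -/
def View (In : Type) : ℕ → Type
  | 0 => ℕ × List Bool
  | t + 1 => View In t × Set (In × In × View In t)

section Locality

variable {In : Type}

/-- The knowledge of `v` after `t` rounds of the full-information protocol. -/
def view (N : Net In) (adv : N.V → List Bool) : (t : ℕ) → N.V → View In t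
  | 0, v => (N.ident v, adv v)
  | t + 1, v => (view N adv t v,
      {p | ∃ u, ∃ h : N.graph.Adj v u, p = (N.label v u h, N.label u v h.symm, view N adv t u)})

/-- `Φ` is computable in a constant number of rounds. -/
def IsLocal {α : Type*} (Φ : ∀ N : Net In, (N.V → List Bool) → N.V → α) : Prop :=
  ∃ T, ∀ (N : Net In) (adv : N.V → List Bool) (v : N.V) (N' : Net In) (adv' : N'.V → List Bool)
    (v' : N'.V), view N adv T v = view N' adv' T v' → Φ N adv v = Φ N' adv' v'

variable {N N' : Net In} {adv : N.V → List Bool} {adv' : N'.V → List Bool} {v : N.V} {v' : N'.V}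

theorem view_of_le {t t' : ℕ} (ht : t ≤ t') (h : view N adv t' v = view N' adv' t' v') :
    view N adv t v = view N' adv' t v' := by
  induction ht with
  | refl => exact h
  | step _ ih => exact ih (congrArg Prod.fst h)

theorem view_ident {t : ℕ} (h : view N adv t v = view N' adv' t v') :
    N.ident v = N'.ident v' := congrArg Prod.fst (view_of_le (Nat.zero_le t) h)

theorem view_adv {t : ℕ} (h : view N adv t v = view N' adv' t v') :
    adv v = adv' v' := congrArg Prod.snd (view_of_le (Nat.zero_le t) h)

theorem view_adj {t : ℕ} (h : view N adv (t + 1) v = view N' adv' (t + 1) v') {u : N.V}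
    (hu : N.graph.Adj v u) : ∃ u', ∃ hu' : N'.graph.Adj v' u',
      N.label v u hu = N'.label v' u' hu' ∧ N.label u v hu.symm = N'.label u' v' hu'.symm ∧
      view N adv t u = view N' adv' t u' := by
  have h2 := congrArg Prod.snd h
  have hm : (N.label v u hu, N.label u v hu.symm, view N adv t u) ∈
      (view N adv (t + 1) v).2 := ⟨u, hu, rfl⟩
  rw [h2] at hm
  obtain ⟨u', hu', he⟩ := hm
  simp only [Prod.mk.injEq] at he
  exact ⟨u', hu', he⟩

theorem exists_adj_of_edist_eq_succ {V : Type} {G : SimpleGraph V} {v u : V} {j : ℕ}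
    (h : G.edist v u = (j + 1 : ℕ)) : ∃ w, G.Adj v w ∧ G.edist w u = j := by
  obtain ⟨p, hp⟩ := SimpleGraph.exists_walk_of_edist_ne_top (G := G) (u := v) (v := u) (by simp [h])
  rw [h] at hp
  have hp' : p.length = j + 1 := by exact_mod_cast hp
  cases p with
  | nil => simp at hp'
  | @cons _ w _ hw p =>
    refine ⟨w, hw, le_antisymm ?_ ?_⟩
    · have : p.length = j := by simpa using hp'
      exact this ▸ SimpleGraph.edist_le p
    · have h1 : G.edist v u ≤ G.edist v w + G.edist w u := SimpleGraph.edist_triangle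
      rw [h, SimpleGraph.edist_eq_one_iff_adj.2 hw] at h1
      have hne : G.edist w u ≠ ⊤ := fun ht => by
        have := SimpleGraph.edist_le p
        simp [ht] at this
      lift G.edist w u to ℕ using hne with d
      norm_cast at h1 ⊢
      omega

/-- A shortest path from `v` is followed edge by edge, each edge costing one round of the view. The
path found in `N'` need not be shortest, so only an inequality results. -/
theorem view_ball_le {t : ℕ} (j : ℕ) : ∀ {v : N.V} {v' : N'.V},
    view N adv (t + j) v = view N' adv' (t + j) v' → ∀ {u : N.V}, N.graph.edist v u ≤ (j : ℕ∞) →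
    ∃ u', N'.graph.edist v' u' ≤ N.graph.edist v u ∧ view N adv t u = view N' adv' t u' := by
  induction j with
  | zero =>
    intro v v' h u hu
    have : v = u := by simpa using hu
    subst this
    exact ⟨v', by simp, h⟩
  | succ j ih =>
    intro v v' h u hu
    obtain hu | hu := hu.eq_or_lt
    · obtain ⟨w, hw, hwu⟩ := exists_adj_of_edist_eq_succ hu
      obtain ⟨w', hw', -, -, hv⟩ := view_adj (t := t + j) h hw
      obtain ⟨u', hu', hv'⟩ := ih hv hwu.le
      refine ⟨u', ?_, hv'⟩
      calc N'.graph.edist v' u' ≤ N'.graph.edist v' w' + N'.graph.edist w' u' :=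
            SimpleGraph.edist_triangle
        _ ≤ 1 + j := add_le_add (SimpleGraph.edist_eq_one_iff_adj.2 hw').le (hu'.trans hwu.le)
        _ = N.graph.edist v u := by rw [hu]; push_cast; rw [add_comm]
    · refine ih (view_of_le (Nat.le_succ _) h) ?_
      exact Order.le_of_lt_add_one (by simpa using hu)

/-- The one-sided estimate is applied there and back; unique identifiers force the return to the
same node, so both distances agree. -/
theorem view_ball {t j : ℕ} (h : view N adv (t + j) v = view N' adv' (t + j) v') {u : N.V}
    (hu : N.graph.edist v u ≤ (j : ℕ∞)) :
    ∃ u', N'.graph.edist v' u' = N.graph.edist v u ∧ view N adv t u = view N' adv' t u' := by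
  obtain ⟨u', hu', hv⟩ := view_ball_le j h hu
  obtain ⟨u'', hu'', hv'⟩ := view_ball_le j h.symm (hu'.trans hu)
  have : u'' = u := N.ident.injective (view_ident (hv.trans hv').symm)
  subst this
  exact ⟨u', le_antisymm hu' hu'', hv⟩

variable {α β γ δ : Type*}

theorem IsLocal.map {Φ : ∀ N : Net In, (N.V → List Bool) → N.V → α} (hΦ : IsLocal Φ) (f : α → β) :
    IsLocal fun N adv v => f (Φ N adv v) := by
  obtain ⟨T, hT⟩ := hΦ
  exact ⟨T, fun N adv v N' adv' v' h => congrArg f (hT N adv v N' adv' v' h)⟩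

theorem IsLocal.prodMk {Φ : ∀ N : Net In, (N.V → List Bool) → N.V → α}
    {Ψ : ∀ N : Net In, (N.V → List Bool) → N.V → β} (hΦ : IsLocal Φ) (hΨ : IsLocal Ψ) :
    IsLocal fun N adv v => (Φ N adv v, Ψ N adv v) := by
  obtain ⟨T, hT⟩ := hΦ
  obtain ⟨S, hS⟩ := hΨ
  exact ⟨max T S, fun N adv v N' adv' v' h => Prod.ext
    (hT _ _ _ _ _ _ (view_of_le (le_max_left _ _) h))
    (hS _ _ _ _ _ _ (view_of_le (le_max_right _ _) h))⟩

theorem IsLocal.map₂ {Φ : ∀ N : Net In, (N.V → List Bool) → N.V → α}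
    {Ψ : ∀ N : Net In, (N.V → List Bool) → N.V → β} (hΦ : IsLocal Φ) (hΨ : IsLocal Ψ)
    (f : α → β → γ) : IsLocal fun N adv v => f (Φ N adv v) (Ψ N adv v) :=
  (hΦ.prodMk hΨ).map fun p => f p.1 p.2

theorem IsLocal.map₃ {Φ : ∀ N : Net In, (N.V → List Bool) → N.V → α}
    {Ψ : ∀ N : Net In, (N.V → List Bool) → N.V → β}
    {Ξ : ∀ N : Net In, (N.V → List Bool) → N.V → γ} (hΦ : IsLocal Φ) (hΨ : IsLocal Ψ)
    (hΞ : IsLocal Ξ) (f : α → β → γ → δ) :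
    IsLocal fun N adv v => f (Φ N adv v) (Ψ N adv v) (Ξ N adv v) :=
  (hΦ.prodMk (hΨ.prodMk hΞ)).map fun p => f p.1 p.2.1 p.2.2

theorem isLocal_ident : IsLocal fun (N : Net In) _ v => N.ident v :=
  ⟨0, fun _ _ _ _ _ _ h => view_ident h⟩

theorem isLocal_adv : IsLocal fun (N : Net In) adv (v : N.V) => adv v :=
  ⟨0, fun _ _ _ _ _ _ h => view_adv h⟩

/-- The identifiers of the neighbours of a node. -/
def nbrIds (N : Net In) (v : N.V) : Set ℕ := {i | ∃ u, N.graph.Adj v u ∧ N.ident u = i}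

theorem isLocal_nbrIds : IsLocal fun (N : Net In) _ v => nbrIds N v := by
  refine ⟨1, fun N adv v N' adv' v' h => Set.Subset.antisymm ?_ ?_⟩
  · rintro _ ⟨u, hu, rfl⟩
    obtain ⟨u', hu', -, -, hv⟩ := view_adj h hu
    exact ⟨u', hu', (view_ident hv).symm⟩
  · rintro _ ⟨u, hu, rfl⟩
    obtain ⟨u', hu', -, -, hv⟩ := view_adj h.symm hu
    exact ⟨u', hu', (view_ident hv).symm⟩

/-- The values of `φ` at the nodes at distance at most `j`, with their distances. -/
def gather (N : Net In) (j : ℕ) (φ : N.V → α) (v : N.V) : Set (ℕ∞ × α) :=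
  {p | ∃ u, N.graph.edist v u ≤ (j : ℕ∞) ∧ p = (N.graph.edist v u, φ u)}

theorem IsLocal.gather {Φ : ∀ N : Net In, (N.V → List Bool) → N.V → α} (hΦ : IsLocal Φ) (j : ℕ) :
    IsLocal fun N adv v => gather N j (Φ N adv) v := by
  obtain ⟨T, hT⟩ := hΦ
  refine ⟨T + j, fun N adv v N' adv' v' h => Set.Subset.antisymm ?_ ?_⟩
  · rintro _ ⟨u, hu, rfl⟩
    obtain ⟨u', hu', hv⟩ := view_ball h hu
    exact ⟨u', hu'.trans_le hu, Prod.ext hu'.symm (hT _ _ _ _ _ _ hv)⟩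
  · rintro _ ⟨u, hu, rfl⟩
    obtain ⟨u', hu', hv⟩ := view_ball h.symm hu
    exact ⟨u', hu'.trans_le hu, Prod.ext hu'.symm (hT _ _ _ _ _ _ hv)⟩

open scoped Classical in
/-- The value of `φ` at the node with identifier `i v`, if it is at distance at most `j`. -/
noncomputable def lookup [Nonempty α] (N : Net In) (j : ℕ) (i : N.V → ℕ) (φ : N.V → α)
    (v : N.V) : α :=
  if h : ∃ u, N.graph.edist v u ≤ (j : ℕ∞) ∧ N.ident u = i v then φ h.choose
  else Classical.arbitrary α

theorem lookup_eq [Nonempty α] {j : ℕ} {i : N.V → ℕ} {φ : N.V → α} {u : N.V}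
    (hu : N.graph.edist v u ≤ (j : ℕ∞)) (hi : N.ident u = i v) : lookup N j i φ v = φ u := by
  have h : ∃ u, N.graph.edist v u ≤ (j : ℕ∞) ∧ N.ident u = i v := ⟨u, hu, hi⟩
  rw [lookup, dif_pos h]
  congr 1
  exact N.ident.injective (h.choose_spec.2.trans hi.symm)

/-- At most one node carries a given identifier, so the values gathered with their identifiers
determine the result. -/
theorem IsLocal.lookup [Nonempty α] {Φ : ∀ N : Net In, (N.V → List Bool) → N.V → α}
    {i : ∀ N : Net In, (N.V → List Bool) → N.V → ℕ} (hΦ : IsLocal Φ) (hi : IsLocal i) (j : ℕ) :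
    IsLocal fun N adv v => lookup N j (i N adv) (Φ N adv) v := by
  classical
  have hg := (isLocal_ident.prodMk hΦ).gather j
  let f : ℕ → Set (ℕ∞ × ℕ × α) → α := fun k S =>
    if h : ∃ p ∈ S, p.2.1 = k then h.choose.2.2 else Classical.arbitrary α
  convert hi.map₂ hg f using 4 with N adv v
  by_cases h : ∃ u, N.graph.edist v u ≤ (j : ℕ∞) ∧ N.ident u = i N adv v
  · obtain ⟨u, hu, hui⟩ := h
    rw [lookup_eq hu hui]
    have h' : ∃ p ∈ LocalAdvice.gather N j (fun v => (N.ident v, Φ N adv v)) v,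
        p.2.1 = i N adv v := ⟨_, ⟨u, hu, rfl⟩, hui⟩
    simp only [f]
    rw [dif_pos h']
    obtain ⟨⟨w, hw, hpw⟩, hpi⟩ := h'.choose_spec
    rw [hpw] at hpi ⊢
    rw [N.ident.injective (hui.trans hpi.symm)]
  · rw [LocalAdvice.lookup, dif_neg h]
    simp only [f]
    rw [dif_neg]
    rintro ⟨_, ⟨u, hu, rfl⟩, hui⟩
    exact h ⟨u, hu, hui⟩

end Locality

/-! ### The full-information algorithm -/

section Algorithm

variable {In Out : Type}

/-- The full-information algorithm, whose output after `T` rounds is computed by `g`. A state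
consists of the identifier, the input labels, the identifiers of the neighbours at the ports, and
the view. -/
noncomputable def fullInfo (T : ℕ) (g : View In T → ℕ → Out) : LocalAlgorithm In Out where
  State := (ℕ × (ℕ → Option In)) × (ℕ → ℕ) × Σ t, View In t
  Msg := Option In × ℕ × Σ t, View In t
  init _ _ i adv d inp :=
    ((i, fun k => if h : k < d then some (inp ⟨k, h⟩) else none), fun _ => 0, ⟨0, (i, adv)⟩)
  send s k := (s.1.2 k, s.1.1, s.2.2)
  receive s d m := (s.1, fun k => if h : k < d then (m ⟨k, h⟩).2.1 else 0,
    ⟨s.2.2.1 + 1, s.2.2.2, {p | ∃ k : Fin d, s.1.2 k = some p.1 ∧ (m k).1 = some p.2.1 ∧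
      (m k).2.2 = ⟨s.2.2.1, p.2.2⟩}⟩)
  output s k := if h : s.2.2.1 = T then some (g (h ▸ s.2.2.2) (s.2.1 k)) else none

variable {T : ℕ} {g : View In T → ℕ → Out} {G : LGraph In} {ident : G.V ↪ ℕ} {p : PortNumbering G}
  {adv : G.V → List Bool}

theorem fullInfo_state_fst (t : ℕ) (v : G.V) :
    ((fullInfo T g).state G ident p adv t v).1 = (ident v, fun k => if h : k < G.deg v then
      some (G.label v ((p v).symm ⟨k, h⟩).1 ((p v).symm ⟨k, h⟩).2) else none) := by
  induction t with
  | zero => rfl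
  | succ t ih => exact ih

theorem fullInfo_state_view (t : ℕ) (v : G.V) :
    ((fullInfo T g).state G ident p adv t v).2.2 =
      ⟨t, view ⟨G, ident⟩ adv t v⟩ := by
  induction t generalizing v with
  | zero => rfl
  | succ t ih =>
    have hrec : ((fullInfo T g).state G ident p adv (t + 1) v).2.2 =
        ⟨((fullInfo T g).state G ident p adv t v).2.2.1 + 1,
          ((fullInfo T g).state G ident p adv t v).2.2.2,
          {q | ∃ k : Fin (G.deg v),
            ((fullInfo T g).state G ident p adv t v).1.2 k = some q.1 ∧
            ((fullInfo T g).state G ident p adv t ((p v).symm k).1).1.2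
              (p ((p v).symm k).1 ⟨v, ((p v).symm k).2.symm⟩).1 = some q.2.1 ∧
            ((fullInfo T g).state G ident p adv t ((p v).symm k).1).2.2 =
              ⟨((fullInfo T g).state G ident p adv t v).2.2.1, q.2.2⟩}⟩ := rfl
    rw [hrec, ih v]
    refine congrArg (Sigma.mk (t + 1)) (Prod.ext rfl (Set.ext fun q => ?_))
    obtain ⟨a, b, w⟩ := q
    simp only [Set.mem_ofPred_eq, fullInfo_state_fst, ih, Fin.is_lt, dite_true, Fin.eta,
      Option.some.injEq, Equiv.symm_apply_apply, Sigma.mk.inj_iff, heq_eq_eq, true_and, view,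
      Prod.mk.injEq]
    constructor
    · rintro ⟨k, ha, hb, hw⟩
      exact ⟨((p v).symm k).1, ((p v).symm k).2, ha.symm, hb.symm, hw.symm⟩
    · rintro ⟨u, hu, ha, hb, hw⟩
      refine ⟨p v ⟨u, hu⟩, ?_⟩
      simp [ha, hb, hw]

theorem fullInfo_state_nbr (t : ℕ) (v u : G.V) (h : G.graph.Adj v u) :
    ((fullInfo T g).state G ident p adv (t + 1) v).2.1 (p v ⟨u, h⟩).1 = ident u := by
  have hrec : ((fullInfo T g).state G ident p adv (t + 1) v).2.1 (p v ⟨u, h⟩).1 =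
      if h' : (p v ⟨u, h⟩).1 < G.deg v then
        ((fullInfo T g).state G ident p adv t
          ((p v).symm ⟨(p v ⟨u, h⟩).1, h'⟩).1).1.1 else 0 := rfl
  rw [hrec, dif_pos (Fin.is_lt _), fullInfo_state_fst]
  simp

/-- The output at a port depends on the identifier of the neighbour there, which is unknown before
the first round; hence `T + 1`. -/
theorem fullInfo_produces {T : ℕ} {g : View In (T + 1) → ℕ → Out} :
    (fullInfo (T + 1) g).Produces G ident p adv (T + 1)
      (fun u v _ => g (view ⟨G, ident⟩ adv (T + 1) u) (ident v)) := by
  intro u v h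
  have hout : (fullInfo (T + 1) g).output ((fullInfo (T + 1) g).state G ident p adv (T + 1) u)
      (p u ⟨v, h⟩).1 =
      if h' : ((fullInfo (T + 1) g).state G ident p adv (T + 1) u).2.2.1 = T + 1 then
        some (g (h' ▸ ((fullInfo (T + 1) g).state G ident p adv (T + 1) u).2.2.2)
          (((fullInfo (T + 1) g).state G ident p adv (T + 1) u).2.1 (p u ⟨v, h⟩).1))
      else none := rfl
  rw [hout, fullInfo_state_nbr, fullInfo_state_view]
  simp

/-- Whatever is determined by a view of constant radius is the output of a LOCAL algorithm. -/
theorem IsLocal.exists_algorithm [Nonempty Out]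
    {Φ : ∀ N : Net In, (N.V → List Bool) → N.V → ℕ → Out} (hΦ : IsLocal Φ) :
    ∃ (T : ℕ) (A : LocalAlgorithm In Out), ∀ (G : LGraph In) (ident : G.V ↪ ℕ)
      (p : PortNumbering G) (adv : G.V → List Bool), A.Produces G ident p adv T
        (fun u v _ => Φ ⟨G, ident⟩ adv u (ident v)) := by
  classical
  obtain ⟨T, hT⟩ := hΦ
  -- Any network that realises the view may be consulted: by locality the value does not depend on
  -- the choice.
  let g : View In (T + 1) → ℕ → Out := fun w =>
    if h : ∃ (N : Net In) (adv : N.V → List Bool) (v : N.V), view N adv (T + 1) v = w then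
      Φ h.choose h.choose_spec.choose h.choose_spec.choose_spec.choose
    else Classical.arbitrary _
  have hg : ∀ (N : Net In) adv v, g (view N adv (T + 1) v) = Φ N adv v := by
    intro N adv v
    have h : ∃ (N' : Net In) (adv' : N'.V → List Bool) (v' : N'.V),
      view N' adv' (T + 1) v' = view N adv (T + 1) v := ⟨N, adv, v, rfl⟩
    simp only [g]
    rw [dif_pos h]
    exact hT _ _ _ _ _ _
      (view_of_le (Nat.le_succ T) h.choose_spec.choose_spec.choose_spec)
  refine ⟨T + 1, fullInfo (T + 1) g, fun G ident p adv => ?_⟩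
  have := fullInfo_produces (T := T) (g := g) (G := G) (ident := ident) (p := p) (adv := adv)
  simpa only [hg] using this

end Algorithm

/-! ### Constraints seen in views -/

section Checking

variable {In Out : Type}

/-- The output labels that `g` assigns, in terms of identifiers. -/
abbrev idLabel (N : Net In) (g : ℕ → ℕ → Out) (u v : N.V) (_ : N.graph.Adj u v) : Out :=
  g (N.ident u) (N.ident v)

/-- The labellings, in terms of identifiers, that satisfy the constraint of `P` at `w`. -/
def satAt (P : LCL In Out) (N : Net In) (w : N.V) : Set (ℕ → ℕ → Out) :=
  {g | ∃ H ∈ P.C, RootedIso ((N.pairLabel (idLabel N g)).ball w P.r)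
    ((N.pairLabel (idLabel N g)).ballRoot w P.r) H}

theorem rootedIso_of_equiv {L : Type} {G G' : LGraph L} {v : G.V} {v' : G'.V} {H : RootedLGraph L}
    (e : G.graph ≃g G'.graph) (hv : e v = v')
    (hl : ∀ a b (h : G.graph.Adj a b), G'.label (e a) (e b) (e.map_rel_iff.2 h) = G.label a b h)
    (hH : RootedIso G' v' H) : RootedIso G v H := by
  obtain ⟨φ, hφ, hφl⟩ := hH
  refine ⟨e.trans φ, by simp [hv, hφ], fun a b h => ?_⟩
  rw [← hl a b h, ← hφl]
  rfl

/-- The view of radius `r + 1` shows every node of the ball together with its incident edges and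
their labels. Matching nodes by identifier is then an isomorphism of balls, and it respects `g`,
which only reads identifiers. -/
theorem satAt_subset_of_view_eq (P : LCL In Out) {N N' : Net In} {adv : N.V → List Bool}
    {adv' : N'.V → List Bool} {w : N.V} {w' : N'.V}
    (h : view N adv (1 + P.r) w = view N' adv' (1 + P.r) w') : satAt P N' w' ⊆ satAt P N w := by
  rintro g ⟨H, hH, hiso⟩
  refine ⟨H, hH, ?_⟩
  choose f hfd hfv using fun u : N.nbhd w P.r => view_ball h u.2
  choose f' hfd' hfv' using fun u : N'.nbhd w' P.r => view_ball h.symm u.2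
  let e : N.nbhd w P.r ≃ N'.nbhd w' P.r :=
    { toFun := fun u => ⟨f u, (hfd u).trans_le u.2⟩
      invFun := fun u => ⟨f' u, (hfd' u).trans_le u.2⟩
      left_inv := fun u => Subtype.ext (N.ident.injective
        ((view_ident (hfv' _)).symm.trans (view_ident (hfv u)).symm))
      right_inv := fun u => Subtype.ext (N'.ident.injective
        ((view_ident (hfv _)).symm.trans (view_ident (hfv' u)).symm)) }
  have hid : ∀ u, N.ident u.1 = N'.ident (e u).1 := fun u => view_ident (hfv u)
  have hdist : ∀ u, N'.graph.edist w' (e u).1 = N.graph.edist w u.1 := hfd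
  have hadj : ∀ a b : N.nbhd w P.r, ∀ hab : N.graph.Adj a.1 b.1,
      ∃ hab' : N'.graph.Adj (e a).1 (e b).1, N'.label _ _ hab' = N.label _ _ hab := by
    intro a b hab
    obtain ⟨c, hc, hl, -, hv⟩ := view_adj (t := 0) (hfv a) hab
    have : c = (e b).1 := N'.ident.injective ((view_ident hv).symm.trans (hid b))
    subst this
    exact ⟨hc, hl.symm⟩
  have hadj' : ∀ a b : N.nbhd w P.r, N'.graph.Adj (e a).1 (e b).1 → N.graph.Adj a.1 b.1 := by
    intro a b hab
    obtain ⟨c, hc, hl, -, hv⟩ := view_adj (t := 0) (hfv a).symm hab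
    have : c = b.1 := N.ident.injective ((view_ident hv).symm.trans (hid b).symm)
    exact this ▸ hc
  have hiff : ∀ a b : N.nbhd w P.r, (N'.graph.Adj (e a).1 (e b).1 ∧
      (N'.graph.edist w' (e a).1 < (P.r : ℕ∞) ∨ N'.graph.edist w' (e b).1 < (P.r : ℕ∞))) ↔
      (N.graph.Adj a.1 b.1 ∧
      (N.graph.edist w a.1 < (P.r : ℕ∞) ∨ N.graph.edist w b.1 < (P.r : ℕ∞))) := by
    intro a b
    rw [hdist, hdist]
    exact and_congr_left fun _ => ⟨hadj' a b, fun hab => (hadj a b hab).1⟩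
  have hg : ∀ a b : N.nbhd w P.r, g (N'.ident (e a).1) (N'.ident (e b).1) =
      g (N.ident a.1) (N.ident b.1) := fun a b => by rw [hid, hid]
  refine rootedIso_of_equiv (G' := (N'.pairLabel (idLabel N' g)).ball w' P.r)
    ⟨e, fun {a b} => hiff a b⟩ ?_ ?_ hiso
  · exact Subtype.ext (N'.ident.injective ((hid _).symm.trans (view_ident h)))
  · exact fun a b hab => Prod.ext (hadj a b hab.1).2 (hg a b)

theorem isLocal_satAt (P : LCL In Out) :
    IsLocal fun (N : Net In) _ w => satAt P N w :=
  ⟨1 + P.r, fun _ _ _ _ _ _ h => Set.Subset.antisymm (satAt_subset_of_view_eq P h.symm)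
    (satAt_subset_of_view_eq P h)⟩

/-- Constraints only depend on the labels in the neighbourhood. -/
theorem rootedIso_ball_congr {G : LGraph In} {w : G.V} {r : ℕ} {H : RootedLGraph (In × Out)}
    {ℓ ℓ' : ∀ u v : G.V, G.graph.Adj u v → Out}
    (h : ∀ u v (huv : G.graph.Adj u v), G.graph.edist w u ≤ (r : ℕ∞) → ℓ u v huv = ℓ' u v huv)
    (hH : RootedIso ((G.pairLabel ℓ').ball w r) ((G.pairLabel ℓ').ballRoot w r) H) :
    RootedIso ((G.pairLabel ℓ).ball w r) ((G.pairLabel ℓ).ballRoot w r) H :=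
  rootedIso_of_equiv (G' := (G.pairLabel ℓ').ball w r) ⟨Equiv.refl _, Iff.rfl⟩ rfl
    (fun a b hab => Prod.ext rfl (h a.1 b.1 hab.1 a.2).symm) hH

end Checking

/-! ### Clusters with small boundary -/

section Carving

variable {X : Type*}

/-- Breadth-first layers from `x` inside `U`, along the relation `E`. -/
noncomputable def bfs (E : X → X → Prop) (U : Finset X) (x : X) : ℕ → Finset X
  | 0 => {x}
  | j + 1 => by classical exact U.filter fun y => ∃ z ∈ bfs E U x j, E z y

variable {E : X → X → Prop} {U : Finset X} {x : X}

theorem mem_bfs_succ {j : ℕ} {y : X} :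
    y ∈ bfs E U x (j + 1) ↔ y ∈ U ∧ ∃ z ∈ bfs E U x j, E z y := by
  simp [bfs]

theorem bfs_subset (hx : x ∈ U) (j : ℕ) : bfs E U x j ⊆ U := by
  cases j with
  | zero => simpa [bfs] using hx
  | succ j => exact fun y hy => (mem_bfs_succ.1 hy).1

theorem bfs_subset_succ (hrefl : ∀ x, E x x) (hx : x ∈ U) (j : ℕ) :
    bfs E U x j ⊆ bfs E U x (j + 1) :=
  fun y hy => mem_bfs_succ.2 ⟨bfs_subset hx j hy, y, hy, hrefl y⟩

theorem root_mem_bfs (hrefl : ∀ x, E x x) (hx : x ∈ U) (j : ℕ) : x ∈ bfs E U x j := by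
  induction j with
  | zero => simp [bfs]
  | succ j ih => exact bfs_subset_succ hrefl hx j ih

/-- New points choose a parent in the previous layer, old points keep theirs. The root is its own
parent, so surplus iterations are harmless and one exponent serves all points. -/
theorem exists_bfs_parent (hrefl : ∀ x, E x x) (hsymm : ∀ x y, E x y → E y x) (hx : x ∈ U)
    (j : ℕ) : ∃ par : X → X, par x = x ∧
      ∀ y ∈ bfs E U x j, par y ∈ bfs E U x j ∧ E y (par y) ∧ par^[j] y = x := by
  classical
  induction j with
  | zero => exact ⟨id, rfl, by simpa [bfs] using hrefl x⟩
  | succ j ih =>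
    obtain ⟨par, hpx, hpar⟩ := ih
    have hz : ∀ y, ∃ z, y ∈ bfs E U x (j + 1) → z ∈ bfs E U x j ∧ E z y := fun y => by
      by_cases hy : y ∈ bfs E U x (j + 1)
      · obtain ⟨z, hz⟩ := (mem_bfs_succ.1 hy).2
        exact ⟨z, fun _ => hz⟩
      · exact ⟨y, fun h => absurd h hy⟩
    choose f hf using hz
    let par' : X → X := fun y => if y ∈ bfs E U x j then par y else f y
    have hold : ∀ y ∈ bfs E U x j, par' y = par y := fun y hy => if_pos hy
    have hiter : ∀ i, ∀ y ∈ bfs E U x j, par'^[i] y = par^[i] y := by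
      intro i
      induction i with
      | zero => simp
      | succ i ih =>
        intro y hy
        rw [Function.iterate_succ_apply, Function.iterate_succ_apply, hold y hy]
        exact ih _ (hpar y hy).1
    refine ⟨par', (hold x (root_mem_bfs hrefl hx j)).trans hpx, fun y hy => ?_⟩
    by_cases hyj : y ∈ bfs E U x j
    · rw [Function.iterate_succ_apply', hiter j y hyj, (hpar y hyj).2.2,
        hold x (root_mem_bfs hrefl hx j), hold y hyj]
      exact ⟨bfs_subset_succ hrefl hx j (hpar y hyj).1, (hpar y hyj).2.1, hpx⟩
    · have hy' : par' y = f y := if_neg hyj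
      obtain ⟨h1, h2⟩ := hf y hy
      rw [Function.iterate_succ_apply, hy', hiter j _ h1]
      exact ⟨bfs_subset_succ hrefl hx j h1, hsymm _ _ h2, (hpar _ h1).2.2⟩

/-- If the layers grow slowly, one of them has a small outer boundary. -/
theorem exists_small_boundary [DecidableEq X] (hrefl : ∀ x, E x x) (hx : x ∈ U) {N k : ℕ}
    (hgrow : (bfs E U x k).card * N ^ k < (N + 1) ^ k) :
    ∃ j < k, N * (bfs E U x (j + 1) \ bfs E U x j).card ≤ (bfs E U x j).card := by
  by_contra! h
  -- Otherwise each layer exceeds the previous one by a factor of more than `1 + 1/N`.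
  suffices ∀ i ≤ k, (N + 1) ^ i ≤ (bfs E U x i).card * N ^ i from
    absurd (this k le_rfl) (not_le.2 hgrow)
  intro i hi
  induction i with
  | zero => simp [bfs]
  | succ i ih =>
    have h1 := h i hi
    have h2 := Finset.card_sdiff_add_card_eq_card (bfs_subset_succ (E := E) hrefl hx i)
    have h3 : (N + 1) * (bfs E U x i).card ≤ N * (bfs E U x (i + 1)).card := by
      rw [← h2]; linarith
    calc (N + 1) ^ (i + 1) = (N + 1) * (N + 1) ^ i := by ring
      _ ≤ (N + 1) * ((bfs E U x i).card * N ^ i) := by gcongr; exact ih (by omega)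
      _ = ((N + 1) * (bfs E U x i).card) * N ^ i := by ring
      _ ≤ (N * (bfs E U x (i + 1)).card) * N ^ i := by gcongr
      _ = _ := by ring

theorem iterate_congr {f g : X → X} {S : Set X} (hS : ∀ y ∈ S, g y ∈ S)
    (h : ∀ y ∈ S, f y = g y) (i : ℕ) : ∀ y ∈ S, f^[i] y = g^[i] y ∧ g^[i] y ∈ S := by
  induction i with
  | zero => simp
  | succ i ih =>
    intro y hy
    rw [Function.iterate_succ_apply, Function.iterate_succ_apply, h y hy]
    exact ih _ (hS y hy)

-- Ball growing: a BFS ball `Q` with small outer boundary `O` is removed from `U`, and the rest is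
-- treated by induction. Elements of `Q` host themselves; elements outside that become boundary only
-- because of `Q` are hosted by a neighbour in `Q`; all others keep their host. So `Q` hosts only
-- boundary elements in `O` or adjacent to it, at most `(D + 1) * O.card` of them, which explains
-- the factor `N * (D + 1)` in the growth condition.
open scoped Classical in
theorem exists_carving_finset {N D k : ℕ} (hrefl : ∀ x, E x x) (hsymm : ∀ x y, E x y → E y x)
    (hD : ∀ (x : X) (S : Finset X), (∀ y ∈ S, E x y) → S.card ≤ D)
    (hgrow : ∀ (U : Finset X), ∀ x ∈ U,
      (bfs E U x k).card * (N * (D + 1)) ^ k < (N * (D + 1) + 1) ^ k) (U : Finset X) :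
    ∃ par host : X → X, (∀ x ∈ U, par x ∈ U ∧ E x (par x)) ∧ (∀ x ∈ U, host x ∈ U ∧ E x (host x)) ∧
      ∀ q, N * (U.filter fun x => (∃ y ∈ U, E x y ∧ par^[k] y ≠ par^[k] x) ∧
        par^[k] (host x) = q).card ≤ (U.filter fun x => par^[k] x = q).card := by
  induction U using Finset.strongInduction with
  | H U ih =>
  obtain rfl | ⟨x, hx⟩ := U.eq_empty_or_nonempty
  · exact ⟨id, id, by simp⟩
  obtain ⟨j, hj, hsmall⟩ := exists_small_boundary hrefl hx (hgrow U x hx)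
  set Q := bfs E U x j with hQ
  have hQU : Q ⊆ U := bfs_subset hx j
  have hxQ : x ∈ Q := root_mem_bfs hrefl hx j
  obtain ⟨parQ, hparx, hparQ⟩ := exists_bfs_parent hrefl hsymm hx j
  obtain ⟨par', host', hpar', hhost', hcount'⟩ := ih (U \ Q)
    (Finset.sdiff_ssubset hQU ⟨x, hxQ⟩)
  have hbd : ∀ y ∈ U \ Q, ∀ z ∈ Q, E z y → y ∈ bfs E U x (j + 1) \ Q := by
    intro y hy z hz hzy
    rw [Finset.mem_sdiff] at hy ⊢
    exact ⟨mem_bfs_succ.2 ⟨hy.1, z, hz, hzy⟩, hy.2⟩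
  let par : X → X := fun y => if y ∈ Q then parQ y else par' y
  let B' : X → Prop := fun y => ∃ z ∈ U \ Q, E y z ∧ par'^[k] z ≠ par'^[k] y
  let host : X → X := fun y => if y ∈ Q then y else if B' y then host' y else
    if h : ∃ z ∈ Q, E y z then h.choose else host' y
  have hrootQ : ∀ y ∈ Q, par^[k] y = x := by
    intro y hy
    rw [((iterate_congr (f := par) (S := (Q : Set X)) (fun y hy => (hparQ y hy).1)
      (fun y hy => if_pos hy) k) y hy).1]
    -- The root is reached after `j < k` iterations, and the remaining ones stay at this fixed
    -- point.
    obtain ⟨i, rfl⟩ := Nat.exists_eq_add_of_lt hj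
    rw [show j + i + 1 = (i + 1) + j by omega, Function.iterate_add_apply, (hparQ y hy).2.2]
    exact Function.iterate_fixed hparx _
  have hrootU : ∀ y ∈ U \ Q, par^[k] y = par'^[k] y ∧ par'^[k] y ∈ U \ Q := by
    intro y hy
    exact iterate_congr (S := ((U \ Q : Finset X) : Set X)) (fun y hy => (hpar' y hy).1)
      (fun y hy => if_neg (Finset.mem_sdiff.1 hy).2) k y hy
  have hsplit : ∀ y ∈ U, y ∈ Q ∨ y ∈ U \ Q := fun y hy => by
    by_cases h : y ∈ Q <;> simp [h, hy]
  have hxne : ∀ y ∈ U \ Q, par^[k] y ≠ x := fun y hy h => by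
    have := (hrootU y hy)
    rw [← this.1, h] at this
    exact (Finset.mem_sdiff.1 this.2).2 hxQ
  have hhQ : ∀ y ∈ Q, host y = y := fun y hy => if_pos hy
  have hhB : ∀ y ∈ U \ Q, B' y → host y = host' y := fun y hy hB => by
    simp only [host, if_neg (Finset.mem_sdiff.1 hy).2, if_pos hB]
  have hhN : ∀ y ∈ U \ Q, ¬ B' y → ∀ z ∈ Q, E y z → host y ∈ Q ∧ E y (host y) := by
    intro y hy hB z hz hyz
    have h : ∃ z ∈ Q, E y z := ⟨z, hz, hyz⟩
    have : host y = h.choose := by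
      simp only [host, if_neg (Finset.mem_sdiff.1 hy).2, if_neg hB, dif_pos h]
    rw [this]
    exact h.choose_spec
  have hhE : ∀ y ∈ U \ Q, ¬ B' y → (¬ ∃ z ∈ Q, E y z) → host y = host' y := by
    intro y hy hB h
    simp only [host, if_neg (Finset.mem_sdiff.1 hy).2, if_neg hB, dif_neg h]
  refine ⟨par, host, ?_, ?_, fun q => ?_⟩
  · intro y hy
    obtain h | h := hsplit y hy
    · simp only [par, if_pos h]
      exact ⟨hQU (hparQ y h).1, (hparQ y h).2.1⟩
    · simp only [par, if_neg (Finset.mem_sdiff.1 h).2]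
      exact ⟨Finset.sdiff_subset (hpar' y h).1, (hpar' y h).2⟩
  · intro y hy
    obtain h | h := hsplit y hy
    · rw [hhQ y h]
      exact ⟨hy, hrefl y⟩
    · have h' : host' y ∈ U ∧ E y (host' y) :=
        ⟨Finset.sdiff_subset (hhost' y h).1, (hhost' y h).2⟩
      by_cases hB : B' y
      · rwa [hhB y h hB]
      · by_cases hz : ∃ z ∈ Q, E y z
        · obtain ⟨z, hz, hyz⟩ := hz
          have := hhN y h hB z hz hyz
          exact ⟨hQU this.1, this.2⟩
        · rwa [hhE y h hB hz]
  · by_cases hq : q = x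
    · subst hq
      set O := bfs E U q (j + 1) \ Q
      -- A boundary element of `Q` has a neighbour outside `Q`, which lies in `O`. An element
      -- outside `Q` with its host in `Q` is adjacent to `Q`, so it lies in `O` itself.
      have hsub : (U.filter fun x => (∃ y ∈ U, E x y ∧ par^[k] y ≠ par^[k] x) ∧
          par^[k] (host x) = q) ⊆ O ∪ O.biUnion fun z => Q.filter fun y => E z y := by
        intro y hy
        obtain ⟨hyU, ⟨z, hz, hyz, hne⟩, hroot⟩ := Finset.mem_filter.1 hy
        rw [Finset.mem_union, Finset.mem_biUnion]
        obtain h | h := hsplit y hyU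
        · right
          obtain hz' | hz' := hsplit z hz
          · exact absurd ((hrootQ z hz').trans (hrootQ y h).symm) hne
          · exact ⟨z, hbd z hz' y h hyz, Finset.mem_filter.2 ⟨h, hsymm _ _ hyz⟩⟩
        · left
          by_cases hB : B' y
          · rw [hhB y h hB] at hroot
            exact absurd hroot (hxne _ (hhost' y h).1)
          · by_cases hz : ∃ z ∈ Q, E y z
            · obtain ⟨z, hz, hyz⟩ := hz
              exact hbd y h z hz (hsymm _ _ hyz)
            · rw [hhE y h hB hz] at hroot
              exact absurd hroot (hxne _ (hhost' y h).1)
      have hcard : (O ∪ O.biUnion fun z => Q.filter fun y => E z y).card ≤ (D + 1) * O.card := by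
        refine (Finset.card_union_le _ _).trans ?_
        have := Finset.card_biUnion_le_card_mul O (fun z => Q.filter fun y => E z y) D
          (fun z _ => hD z _ fun y hy => (Finset.mem_filter.1 hy).2)
        linarith
      calc N * _ ≤ N * ((D + 1) * O.card) :=
            Nat.mul_le_mul_left _ ((Finset.card_le_card hsub).trans hcard)
        _ = N * (D + 1) * O.card := by ring
        _ ≤ Q.card := hsmall
        _ ≤ _ := Finset.card_le_card fun y hy => Finset.mem_filter.2 ⟨hQU hy, hrootQ y hy⟩
    -- The other clusters host nothing new: an element that is boundary only because of `Q` was sent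
    -- to `Q`.
    · refine (Nat.mul_le_mul_left _ (Finset.card_le_card ?_)).trans
        ((hcount' q).trans (Finset.card_le_card ?_))
      · intro y hy
        obtain ⟨hyU, ⟨z, hz, hyz, hne⟩, hroot⟩ := Finset.mem_filter.1 hy
        obtain h | h := hsplit y hyU
        · rw [hhQ y h, hrootQ y h] at hroot
          exact absurd hroot.symm hq
        · have hB : B' y ∧ host y = host' y := by
            by_contra hcon
            by_cases hB : B' y
            · exact hcon ⟨hB, hhB y h hB⟩
            · obtain hz' | hz' := hsplit z hz
              · exact hq (hroot.symm.trans (hrootQ _ (hhN y h hB z hz' hyz).1))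
              · exact hB ⟨z, hz', hyz, by rwa [← (hrootU z hz').1, ← (hrootU y h).1]⟩
          rw [hB.2, (hrootU _ (hhost' y h).1).1] at hroot
          exact Finset.mem_filter.2 ⟨h, hB.1, hroot⟩
      · intro y hy
        obtain ⟨h, hroot⟩ := Finset.mem_filter.1 hy
        exact Finset.mem_filter.2 ⟨Finset.sdiff_subset h, (hrootU y h).1.trans hroot⟩

end Carving

/-! ### Encoding bits by ones on geodesics -/

section Beacons

variable {V : Type} {G : SimpleGraph V}

/-- A shortcut between two nodes of a shortest path would shorten the whole path. -/
theorem exists_geodesic {x u : V} {ρ : ℕ} (h : G.edist x u = (ρ : ℕ∞)) :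
    ∃ p : ℕ → V, p 0 = x ∧ ∀ i k, i + k ≤ ρ → G.edist (p i) (p (i + k)) = (k : ℕ∞) := by
  obtain ⟨w, hw⟩ := SimpleGraph.exists_walk_of_edist_ne_top (G := G) (u := x) (v := u) (by simp [h])
  have hlen : w.length = ρ := by rw [h] at hw; exact_mod_cast hw
  have hle : ∀ k i, i + k ≤ ρ → G.edist (w.getVert i) (w.getVert (i + k)) ≤ (k : ℕ∞) := by
    intro k
    induction k with
    | zero => simp
    | succ k ih =>
      intro i hi
      refine SimpleGraph.edist_triangle.trans ((add_le_add (ih i (by omega))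
        (SimpleGraph.edist_eq_one_iff_adj.2 (w.adj_getVert_succ (i := i + k) (by omega))).le).trans ?_)
      push_cast
      exact le_rfl
  refine ⟨w.getVert, w.getVert_zero, fun i k hik => le_antisymm (hle k i hik) ?_⟩
  have h1 : (ρ : ℕ∞) ≤ i + (G.edist (w.getVert i) (w.getVert (i + k)) + (ρ - (i + k) : ℕ)) := by
    calc (ρ : ℕ∞) = G.edist (w.getVert 0) (w.getVert ρ) := by
          rw [w.getVert_zero, ← hlen, w.getVert_length, h, hlen]
      _ ≤ _ := SimpleGraph.edist_triangle (v := w.getVert i)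
      _ ≤ _ := add_le_add (by simpa using hle i 0 (by omega))
          (SimpleGraph.edist_triangle (v := w.getVert (i + k)))
      _ ≤ _ := by
          gcongr
          simpa [Nat.add_sub_cancel' hik] using hle (ρ - (i + k)) (i + k) (by omega)
  have h2 := hle k i hik
  have hne : G.edist (w.getVert i) (w.getVert (i + k)) ≠ ⊤ := fun h => by simp [h] at h2
  lift G.edist (w.getVert i) (w.getVert (i + k)) to ℕ using hne with d
  norm_cast at h1 ⊢
  omega

/-- A node that received a `1` and that has no other such node nearby. -/
def IsCenter (G : SimpleGraph V) (adv : V → List Bool) (s m : ℕ) (v : V) : Prop :=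
  adv v = [true] ∧ ∀ u, G.edist v u ≤ (s * m : ℕ) → adv u = [true] → u = v

/-- The message encoded by the distances of `v` to the nodes that received a `1`. -/
def code (G : SimpleGraph V) (adv : V → List Bool) (s m : ℕ) (v : V) : Set ℕ :=
  {j | j ∈ Set.Icc 1 m ∧ ∃ u, adv u = [true] ∧ G.edist v u = (s * (m + j) : ℕ)}

/-- Each center `x` places ones on its geodesic at position `0` and at `s * (m + j)` for `j ∈ J x`
and for `j = m + 1, m + 2`. The two extra marks ensure that every one except the center has another
one within `s * m`, while the center has none. The message is read off exact distances, undisturbed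
by other centers, whose geodesics are more than `ρ` away. -/
theorem exists_beacons [Fintype V] {s m : ℕ} (hs : 0 < s) (hm : 0 < m) (X : Finset V)
    (hsep : ∀ x ∈ X, ∀ y ∈ X, x ≠ y → ((3 * (2 * s * (m + 1)) : ℕ) : ℕ∞) < G.edist x y)
    (hecc : ∀ x ∈ X, ∃ u, G.edist x u = (2 * s * (m + 1) : ℕ)) (J : V → Set ℕ)
    (hJ : ∀ x, J x ⊆ Set.Icc 1 m) :
    ∃ adv : V → List Bool, (∀ v, adv v = [true] ∨ adv v = [false]) ∧
      s * {v | adv v = [true]}.ncard ≤ Fintype.card V ∧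
      (∀ v, IsCenter G adv s m v ↔ v ∈ X) ∧ ∀ x ∈ X, code G adv s m x = J x := by
  classical
  set ρ := 2 * s * (m + 1) with hρ
  have hpath : ∀ x, ∃ p : ℕ → V, x ∈ X →
      p 0 = x ∧ ∀ i k, i + k ≤ ρ → G.edist (p i) (p (i + k)) = (k : ℕ∞) := fun x => by
    by_cases hx : x ∈ X
    · obtain ⟨u, hu⟩ := hecc x hx
      obtain ⟨p, hp⟩ := exists_geodesic hu
      exact ⟨p, fun _ => hp⟩
    · exact ⟨fun _ => x, fun h => absurd h hx⟩
  choose p hp using hpath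
  have hp0 : ∀ x ∈ X, ∀ t ≤ ρ, G.edist x (p x t) = (t : ℕ∞) := fun x hx t ht => by
    have := (hp x hx).2 0 t (by omega)
    rwa [(hp x hx).1, zero_add] at this
  -- Otherwise `x` and `y` are joined through both geodesics by a walk of length at most `3ρ`.
  have hfar : ∀ x ∈ X, ∀ y ∈ X, x ≠ y → ∀ t ≤ ρ, ∀ t' ≤ ρ,
      (ρ : ℕ∞) < G.edist (p x t) (p y t') := by
    intro x hx y hy hxy t ht t' ht'
    by_contra! hcon
    have h1 : G.edist x y ≤ t + (ρ + t') :=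
      SimpleGraph.edist_triangle.trans (add_le_add (hp0 x hx t ht).le
        (SimpleGraph.edist_triangle.trans
          (add_le_add hcon (SimpleGraph.edist_comm.trans (hp0 y hy t' ht')).le)))
    have h2 := (hsep x hx y hy hxy).trans_le h1
    norm_cast at h2
    omega
  let Pos : V → ℕ → Prop := fun x t =>
    t = 0 ∨ ∃ j, (j ∈ J x ∨ j = m + 1 ∨ j = m + 2) ∧ t = s * (m + j)
  have hrange : ∀ x j, (j ∈ J x ∨ j = m + 1 ∨ j = m + 2) → 1 ≤ j ∧ j ≤ m + 2 := by
    rintro x j (h | h | h)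
    · have := hJ x h
      exact ⟨this.1, this.2.trans (by omega)⟩
    · omega
    · omega
  have hjρ : ∀ j, j ≤ m + 2 → s * (m + j) ≤ ρ := fun j hj => by
    rw [hρ]; nlinarith
  have hposρ : ∀ x t, Pos x t → t ≤ ρ := by
    rintro x t (rfl | ⟨j, hj, rfl⟩)
    · exact Nat.zero_le _
    · exact hjρ j (hrange x j hj).2
  let One : V → Prop := fun u => ∃ x ∈ X, ∃ t, Pos x t ∧ p x t = u
  let adv : V → List Bool := fun u => if One u then [true] else [false]
  have hadv : ∀ u, adv u = [true] ↔ One u := fun u => by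
    by_cases h : One u <;> simp [adv, h]
  have hsmρ : s * m ≤ ρ := by rw [hρ]; nlinarith
  refine ⟨adv, fun v => ?_, ?_, fun v => ⟨?_, ?_⟩, fun x hx => Set.ext fun j => ⟨?_, ?_⟩⟩
  · by_cases h : One v <;> simp [adv, h]
  · have h1 : {v | adv v = [true]} ⊆ ((X ×ˢ insert 0 ((Finset.Icc 1 (m + 2)).image
        fun j => s * (m + j))).image fun q => p q.1 q.2 : Finset V) := by
      intro u hu
      obtain ⟨x, hx, t, ht, rfl⟩ := (hadv u).1 hu
      rw [Finset.mem_coe, Finset.mem_image]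
      refine ⟨(x, t), Finset.mem_product.2 ⟨hx, ?_⟩, rfl⟩
      obtain rfl | ⟨j, hj, rfl⟩ := ht
      · exact Finset.mem_insert_self _ _
      · exact Finset.mem_insert_of_mem (Finset.mem_image_of_mem _
          (Finset.mem_Icc.2 (hrange x j hj)))
    have h2 : {v | adv v = [true]}.ncard ≤ X.card * (m + 3) := by
      refine (Set.ncard_le_ncard h1 (Finset.finite_toSet _)).trans ?_
      rw [Set.ncard_coe_finset]
      refine Finset.card_image_le.trans ?_
      rw [Finset.card_product]
      refine Nat.mul_le_mul_left _ ((Finset.card_insert_le _ _).trans ?_)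
      have := Finset.card_image_le (s := Finset.Icc 1 (m + 2)) (f := fun j => s * (m + j))
      simp only [Nat.card_Icc] at this
      omega
    -- The geodesics are disjoint and have `ρ + 1` nodes each, which is at least `s` times the `m +
    -- 3` possible marks.
    have h3 : X.card * (ρ + 1) ≤ Fintype.card V := by
      rw [← Finset.card_range (ρ + 1), ← Finset.card_product, ← Finset.card_univ]
      refine Finset.card_le_card_of_injOn (fun q => p q.1 q.2) (fun _ _ => Finset.mem_univ _) ?_
      rintro ⟨x, t⟩ hxt ⟨y, t'⟩ hyt he
      simp only [Finset.coe_product, Set.mem_prod, Finset.mem_coe, Finset.mem_range] at hxt hyt he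
      have hxy : x = y := by
        by_contra hxy
        have := hfar x hxt.1 y hyt.1 hxy t (by omega) t' (by omega)
        rw [he] at this
        simp at this
      subst hxy
      have h1 := hp0 x hxt.1 t (by omega)
      rw [he, hp0 x hxt.1 t' (by omega)] at h1
      exact Prod.ext rfl (by exact_mod_cast h1.symm)
    calc s * _ ≤ s * (X.card * (m + 3)) := Nat.mul_le_mul_left _ h2
      _ = X.card * (s * (m + 3)) := by ring
      _ ≤ X.card * (ρ + 1) := Nat.mul_le_mul_left _ (by rw [hρ]; nlinarith)
      _ ≤ _ := h3
  · rintro ⟨hv, hnear⟩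
    obtain ⟨x, hx, t, ht, rfl⟩ := (hadv v).1 hv
    obtain rfl | ⟨j, hj, rfl⟩ := ht
    · rw [(hp x hx).1]; exact hx
    exfalso
    have hjm := hrange x j hj
    -- The marks `m + 1` and `m + 2` see each other at distance `s`; a data mark `j ≤ m` sees the
    -- mark `m + 1` at distance `s * (m + 1 - j) ≤ s * m`.
    by_cases hjm1 : j = m + 1
    · subst hjm1
      have hd := (hp x hx).2 (s * (m + (m + 1))) s
        (by have := hjρ (m + 2) le_rfl; nlinarith)
      have := hnear (p x (s * (m + (m + 1)) + s)) (by
          rw [hd]; exact_mod_cast Nat.le_mul_of_pos_right s hm)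
        ((hadv _).2 ⟨x, hx, _, Or.inr ⟨m + 2, Or.inr (Or.inr rfl), by ring⟩, rfl⟩)
      rw [this, SimpleGraph.edist_self] at hd
      have : 0 = s := by exact_mod_cast hd
      omega
    · have hone : One (p x (s * (m + (m + 1)))) :=
        ⟨x, hx, _, Or.inr ⟨m + 1, Or.inr (Or.inl rfl), rfl⟩, rfl⟩
      obtain hlt | rfl : j ≤ m ∨ j = m + 2 := by omega
      · have he : s * (m + (m + 1)) = s * (m + j) + s * (m + 1 - j) := by
          rw [← mul_add]; congr 1; omega
        have hd := (hp x hx).2 (s * (m + j)) (s * (m + 1 - j))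
          (by rw [← he]; exact hjρ (m + 1) (by omega))
        rw [he] at hone
        have := hnear _ (by
          rw [hd]; exact_mod_cast Nat.mul_le_mul_left s (by omega)) ((hadv _).2 hone)
        rw [this, SimpleGraph.edist_self] at hd
        have h0 : 0 = s * (m + 1 - j) := by exact_mod_cast hd
        have : 0 < s * (m + 1 - j) := Nat.mul_pos hs (by omega)
        omega
      · have hd := (hp x hx).2 (s * (m + (m + 1))) s
          (by have := hjρ (m + 2) le_rfl; nlinarith)
        have he : s * (m + (m + 1)) + s = s * (m + (m + 2)) := by ring
        rw [he] at hd
        have := hnear _ (by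
          rw [SimpleGraph.edist_comm, hd]; exact_mod_cast Nat.le_mul_of_pos_right s hm)
          ((hadv _).2 hone)
        rw [this, SimpleGraph.edist_self] at hd
        have : 0 = s := by exact_mod_cast hd
        omega
  · intro hx
    have hone : One v := ⟨v, hx, 0, Or.inl rfl, (hp v hx).1⟩
    refine ⟨(hadv v).2 hone, fun u hu huone => ?_⟩
    obtain ⟨y, hy, t, ht, rfl⟩ := (hadv u).1 huone
    by_cases hyv : v = y
    · subst hyv
      obtain rfl | ⟨j, hj, rfl⟩ := ht
      · exact (hp v hx).1
      · rw [hp0 v hx _ (hjρ j (hrange v j hj).2)] at hu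
        have h1 : s * (m + j) ≤ s * m := by exact_mod_cast hu
        have := Nat.le_of_mul_le_mul_left h1 hs
        have := (hrange v j hj).1
        omega
    · have h1 := hfar v hx y hy hyv 0 (Nat.zero_le _) t (hposρ y t ht)
      rw [(hp v hx).1] at h1
      have h2 := h1.trans_le hu
      norm_cast at h2
      omega
  · rintro ⟨hj, u, hu, hd⟩
    obtain ⟨y, hy, t, ht, rfl⟩ := (hadv u).1 hu
    by_cases hyx : x = y
    · subst hyx
      rw [hp0 x hx t (hposρ x t ht)] at hd
      have hd' : t = s * (m + j) := by exact_mod_cast hd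
      obtain rfl | ⟨j', hj', rfl⟩ := ht
      · have : 0 < s * (m + j) := Nat.mul_pos hs (by omega)
        omega
      · have := Nat.eq_of_mul_eq_mul_left hs hd'
        obtain rfl : j' = j := by omega
        have := hj.2
        obtain h | h | h := hj'
        · exact h
        · omega
        · omega
    · have h1 := hfar x hx y hy hyx 0 (Nat.zero_le _) t (hposρ y t ht)
      rw [(hp x hx).1, hd] at h1
      norm_cast at h1
      have := hjρ j (hj.2.trans (by omega))
      omega
  · intro hj
    refine ⟨hJ x hj, p x (s * (m + j)),
      (hadv _).2 ⟨x, hx, _, Or.inr ⟨j, Or.inl hj, rfl⟩, rfl⟩, ?_⟩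
    exact hp0 x hx _ (hjρ j (hrange x j (Or.inl hj)).2)

end Beacons

/-! ### Counting arguments for codes -/

section Decoders

/-- The subsets of a large enough finite set encode all elements of a finite type. -/
theorem exists_decoder {β : Type*} [Finite β] [Nonempty β] {B : Set ℕ} (hB : B.Finite)
    (h : Nat.card β ≤ 2 ^ B.ncard) : ∃ D : Set ℕ → β, ∀ b, ∃ S ⊆ B, D S = b := by
  classical
  have := Fintype.ofFinite β
  obtain ⟨e⟩ := Function.Embedding.nonempty_of_card_le (α := β) (β := hB.toFinset.powerset) (by
    rw [Fintype.card_coe, Finset.card_powerset, ← Set.ncard_eq_toFinset_card B hB,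
      ← Nat.card_eq_fintype_card]
    exact h)
  let f : β → Set ℕ := fun b => ((e b : Finset ℕ) : Set ℕ)
  have hf : Function.Injective f := fun a b hab =>
    e.injective (Subtype.ext (Finset.coe_injective hab))
  refine ⟨Function.invFun f, fun b => ⟨f b, ?_, Function.leftInverse_invFun hf b⟩⟩
  have := Finset.mem_powerset.1 (e b).2
  intro i hi
  exact hB.mem_toFinset.1 (this hi)

/-- There are `2 * D ^ 2` triples and `2 ^ m` subsets. -/
theorem exists_pointer_decoder {D m : ℕ} (hD : 2 * D ^ 2 ≤ 2 ^ m) :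
    ∃ dec : Set ℕ → ℕ × ℕ × Bool, ∀ i < D, ∀ j < D, ∀ b, ∃ S ⊆ Set.Icc 1 m, dec S = (i, j, b) := by
  obtain rfl | hpos := Nat.eq_zero_or_pos D
  · exact ⟨fun _ => (0, 0, false), by simp⟩
  have : Nonempty (Fin D) := ⟨⟨0, hpos⟩⟩
  obtain ⟨d, hd⟩ := exists_decoder (β := Fin D × Fin D × Bool) (Set.finite_Icc 1 m) (by
    rw [Nat.card_prod, Nat.card_prod, Nat.card_fin, Nat.card_eq_fintype_card, Fintype.card_bool]
    rw [Set.ncard_eq_toFinset_card']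
    simp only [Set.toFinset_Icc, Nat.card_Icc, Nat.add_sub_cancel]
    linarith)
  refine ⟨fun S => ((d S).1, (d S).2.1, (d S).2.2), fun i hi j hj b => ?_⟩
  obtain ⟨S, hS, h⟩ := hd (⟨i, hi⟩, ⟨j, hj⟩, b)
  exact ⟨S, hS, by simp [h]⟩

/-- One bit per element of `B` suffices to store labels on `A`. -/
theorem exists_label_decoder (Out : Type) [Finite Out] [Nonempty Out] : ∃ dec : Set (ℕ × ℕ) →
    Set ℕ → Set ℕ → ℕ → ℕ → Out, ∀ A B, A.Finite → B.Finite → ∀ c, Nat.card Out ≤ 2 ^ c →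
      c * A.ncard ≤ B.ncard → ∀ g : ℕ → ℕ → Out,
      ∃ S ⊆ B, ∀ p ∈ A, dec A B S p.1 p.2 = g p.1 p.2 := by
  classical
  -- The decoder may depend on `A` and `B`, which the reading node can compute, but not on `g`.
  suffices ∀ A : Set (ℕ × ℕ), ∀ B : Set ℕ, ∃ dec : Set ℕ → ℕ → ℕ → Out, A.Finite → B.Finite →
      ∀ c, Nat.card Out ≤ 2 ^ c → c * A.ncard ≤ B.ncard →
      ∀ g : ℕ → ℕ → Out, ∃ S ⊆ B, ∀ p ∈ A, dec S p.1 p.2 = g p.1 p.2 by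
    choose dec h using this
    exact ⟨dec, h⟩
  intro A B
  by_cases h : A.Finite ∧ B.Finite ∧ ∃ c, Nat.card Out ≤ 2 ^ c ∧ c * A.ncard ≤ B.ncard
  · obtain ⟨hA, hB, c, hc, hcard⟩ := h
    have := hA.to_subtype
    obtain ⟨d, hd⟩ := exists_decoder (β := A → Out) hB (by
      rw [Nat.card_fun, Nat.card_coe_set_eq]
      exact (Nat.pow_le_pow_left hc _).trans
        (by rw [← pow_mul]; exact Nat.pow_le_pow_right (by norm_num) hcard))
    refine ⟨fun S i j => if h : (i, j) ∈ A then d S ⟨(i, j), h⟩ else Classical.arbitrary _,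
      fun _ _ _ _ _ g => ?_⟩
    obtain ⟨S, hS, hdS⟩ := hd fun p => g p.1.1 p.1.2
    refine ⟨S, hS, fun p hp => ?_⟩
    have hp' : (p.1, p.2) ∈ A := hp
    simp only [dif_pos hp', hdS]
  · exact ⟨fun _ _ _ => Classical.arbitrary _, fun hA hB c hc hcard =>
      absurd ⟨hA, hB, c, hc, hcard⟩ h⟩

end Decoders

/-! ### Locality of bounded quantifiers -/

section LocalSets

variable {In : Type} {α β γ : Type*}

/-- Set-valued form of a quantifier over a ball; with `γ = Unit` it covers predicates. -/
theorem IsLocal.setExists {Ψ : ∀ N : Net In, (N.V → List Bool) → N.V → α}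
    {Φ : ∀ N : Net In, (N.V → List Bool) → N.V → β} (hΨ : IsLocal Ψ) (hΦ : IsLocal Φ) (j : ℕ)
    (R : γ → α → ℕ∞ → β → Prop) : IsLocal fun N adv v =>
      {c | ∃ u, N.graph.edist v u ≤ (j : ℕ∞) ∧
        R c (Ψ N adv v) (N.graph.edist v u) (Φ N adv u)} := by
  convert hΨ.map₂ (hΦ.gather j) fun a S => {c | ∃ p ∈ S, R c a p.1 p.2} using 4 with N adv v
  ext c
  constructor
  · rintro ⟨u, hu, h⟩
    exact ⟨_, ⟨u, hu, rfl⟩, h⟩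
  · rintro ⟨_, ⟨u, hu, rfl⟩, h⟩
    exact ⟨u, hu, h⟩

theorem IsLocal.setForall {Ψ : ∀ N : Net In, (N.V → List Bool) → N.V → α}
    {Φ : ∀ N : Net In, (N.V → List Bool) → N.V → β} (hΨ : IsLocal Ψ) (hΦ : IsLocal Φ) (j : ℕ)
    (R : γ → α → ℕ∞ → β → Prop) : IsLocal fun N adv v =>
      {c | ∀ u, N.graph.edist v u ≤ (j : ℕ∞) →
        R c (Ψ N adv v) (N.graph.edist v u) (Φ N adv u)} := by
  convert hΨ.map₂ (hΦ.gather j) fun a S => {c | ∀ p ∈ S, R c a p.1 p.2} using 4 with N adv v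
  ext c
  constructor
  · rintro h _ ⟨u, hu, rfl⟩
    exact h u hu
  · intro h u hu
    exact h _ ⟨u, hu, rfl⟩

end LocalSets

/-! ### The decoder and its locality -/

section Decoding

variable {In Out : Type}

/-- What the advice says about the nodes: which of them are centers, and for each center the
identifiers of its parent and of its host and one stored bit. -/
structure Plan (N : Net In) where
  ctr : N.V → Prop
  par : N.V → ℕ
  host : N.V → ℕ
  bit : N.V → Prop

/-- The identifiers of the nodes at distance at most `j` with the property `p`. -/
def idsNear (N : Net In) (j : ℕ) (p : N.V → Prop) (v : N.V) : Set ℕ :=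
  {i | ∃ u, N.graph.edist v u ≤ (j : ℕ∞) ∧ p u ∧ N.ident u = i}

open scoped Classical in
/-- The identifier of the center at distance at most `M` that has the index `idx v`. -/
noncomputable def pointer (N : Net In) (M : ℕ) (ctr : N.V → Prop) (idx : N.V → ℕ) (v : N.V) : ℕ :=
  if ctr v then Nat.nth (· ∈ idsNear N M ctr v) (idx v) else 0

namespace Plan

variable {N : Net In} (d : Plan N) (j M k R : ℕ)

/-- The identifier of the center in whose tile the node lies. -/
noncomputable def tile (v : N.V) : ℕ := sInf (idsNear N j d.ctr v)

/-- The identifier reached from `v` along `k` parent pointers. -/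
noncomputable def root : ℕ → N.V → ℕ
  | 0, v => N.ident v
  | k + 1, v => lookup N M d.par (root k) v

open scoped Classical in
/-- The identifier of the leader of the cell of `v`. -/
noncomputable def cell (v : N.V) : ℕ :=
  if (idsNear N j d.ctr v).Nonempty then lookup N j (d.tile j) (d.root M k) v
  else sInf (idsNear N j (fun _ => True) v)

/-- The node has a node of another cell nearby. -/
def bdry (r : ℕ) (u : N.V) : Prop :=
  ∃ u', N.graph.edist u u' ≤ (r : ℕ∞) ∧ d.cell j M k u' ≠ d.cell j M k u

/-- The identifier of the leader of the cell that stores the labels at `u`. -/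
noncomputable def hostCell (u : N.V) : ℕ :=
  lookup N j (d.tile j) (lookup N M d.host (d.root M k)) u

/-- The edge-endpoint pairs whose labels the cell with leader `q` stores. -/
def hosted (r : ℕ) (q : N.V) : Set (ℕ × ℕ) :=
  {p | ∃ u, N.graph.edist q u ≤ (R : ℕ∞) ∧ d.bdry j M k r u ∧ d.hostCell j M k u = N.ident q ∧
    p.1 = N.ident u ∧ p.2 ∈ nbrIds N u}

/-- The centers with the property `p` in the cell with leader `q`. -/
def members (p : N.V → Prop) (q : N.V) : Set ℕ :=
  {i | ∃ x, N.graph.edist q x ≤ (R : ℕ∞) ∧ d.ctr x ∧ d.root M k x = N.ident q ∧ p x ∧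
    N.ident x = i}

variable (ldec : Set (ℕ × ℕ) → Set ℕ → Set ℕ → ℕ → ℕ → Out)

/-- The labels stored by the cell with leader `q`. -/
def stored (r : ℕ) (q : N.V) : ℕ → ℕ → Out :=
  ldec (d.hosted j M k R r q) (d.members M k R (fun _ => True) q) (d.members M k R d.bit q)

variable [Nonempty Out]

/-- The labels that the node `u` near a cell boundary learns from its host. -/
noncomputable def learnt (r : ℕ) (u : N.V) : ℕ → ℕ → Out :=
  lookup N R (d.hostCell j M k) (d.stored j M k R ldec r) u

/-- The labellings that satisfy all constraints in the cell with leader `q` and agree with the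
stored labels near cell boundaries. -/
def allowed (P : LCL In Out) (q : N.V) : Set (ℕ → ℕ → Out) :=
  {g | (∀ w, N.graph.edist q w ≤ (R : ℕ∞) → d.cell j M k w = N.ident q → g ∈ satAt P N w) ∧
    ∀ u, N.graph.edist q u ≤ ((R + P.r : ℕ) : ℕ∞) → d.bdry j M k P.r u → ∀ i ∈ nbrIds N u,
      g (N.ident u) i = d.learnt j M k R ldec P.r u (N.ident u) i}

open scoped Classical in
/-- The output of the node `v`: its labels in the labelling that its cell selects. -/
noncomputable def out (P : LCL In Out) (v : N.V) (i : ℕ) : Out :=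
  lookup N R (d.cell j M k) (fun q => Classical.epsilon fun g => g ∈ d.allowed j M k R ldec P q)
    v (N.ident v) i

end Plan

theorem isLocal_const {α : Type*} (a : α) : IsLocal fun (N : Net In) _ (_ : N.V) => a :=
  ⟨0, fun _ _ _ _ _ _ _ => rfl⟩

theorem IsLocal.idsNear {p : ∀ N : Net In, (N.V → List Bool) → N.V → Prop} (hp : IsLocal p)
    (j : ℕ) : IsLocal fun N adv v => idsNear N j (p N adv) v :=
  (isLocal_const ()).setExists (hp.prodMk isLocal_ident) j fun i _ _ b => b.1 ∧ b.2 = i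

theorem IsLocal.pointer {p : ∀ N : Net In, (N.V → List Bool) → N.V → Prop}
    {idx : ∀ N : Net In, (N.V → List Bool) → N.V → ℕ} (hp : IsLocal p) (hi : IsLocal idx) (M : ℕ) :
    IsLocal fun N adv v => pointer N M (p N adv) (idx N adv) v := by
  classical
  exact hp.map₃ (hp.idsNear M) hi fun a S i => if a then Nat.nth (· ∈ S) i else 0

/-- All components of the plan are computable in a constant number of rounds. -/
structure IsLocalPlan (D : ∀ N : Net In, (N.V → List Bool) → Plan N) : Prop where
  ctr : IsLocal fun N adv v => (D N adv).ctr v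
  par : IsLocal fun N adv v => (D N adv).par v
  host : IsLocal fun N adv v => (D N adv).host v
  bit : IsLocal fun N adv v => (D N adv).bit v

namespace IsLocalPlan

variable {D : ∀ N : Net In, (N.V → List Bool) → Plan N} (j M k R : ℕ)

theorem tile (hD : IsLocalPlan D) : IsLocal fun N adv v => (D N adv).tile j v :=
  (hD.ctr.idsNear j).map sInf

theorem root (hD : IsLocalPlan D) : IsLocal fun N adv v => (D N adv).root M k v := by
  induction k with
  | zero => exact isLocal_ident
  | succ k ih => exact ih.lookup hD.par M

theorem cell (hD : IsLocalPlan D) : IsLocal fun N adv v => (D N adv).cell j M k v := by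
  classical
  exact (hD.ctr.idsNear j).map₃ ((hD.root M k).lookup (hD.tile j) j)
    ((isLocal_const True).idsNear j) fun S a T => if S.Nonempty then a else sInf T

theorem bdry (hD : IsLocalPlan D) (r : ℕ) : IsLocal fun N adv v => (D N adv).bdry j M k r v :=
  ((hD.cell j M k).setExists (hD.cell j M k) r fun (_ : Unit) a _ b => b ≠ a).map fun S => () ∈ S

theorem hostCell (hD : IsLocalPlan D) : IsLocal fun N adv v => (D N adv).hostCell j M k v :=
  ((hD.root M k).lookup hD.host M).lookup (hD.tile j) j

theorem hosted (hD : IsLocalPlan D) (r : ℕ) : IsLocal fun N adv v => (D N adv).hosted j M k R r v :=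
  isLocal_ident.setExists ((hD.bdry j M k r).prodMk ((hD.hostCell j M k).prodMk
    (isLocal_ident.prodMk isLocal_nbrIds))) R
    fun (p : ℕ × ℕ) q _ b => b.1 ∧ b.2.1 = q ∧ p.1 = b.2.2.1 ∧ p.2 ∈ b.2.2.2

theorem members (hD : IsLocalPlan D) {p : ∀ N : Net In, (N.V → List Bool) → N.V → Prop}
    (hp : IsLocal p) :
    IsLocal fun N adv v => (D N adv).members M k R (p N adv) v :=
  isLocal_ident.setExists (hD.ctr.prodMk ((hD.root M k).prodMk (hp.prodMk isLocal_ident))) R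
    fun i q _ b => b.1 ∧ b.2.1 = q ∧ b.2.2.1 ∧ b.2.2.2 = i

variable (ldec : Set (ℕ × ℕ) → Set ℕ → Set ℕ → ℕ → ℕ → Out)

theorem stored (hD : IsLocalPlan D) (r : ℕ) :
    IsLocal fun N adv v => (D N adv).stored j M k R ldec r v :=
  (hD.hosted j M k R r).map₃ (hD.members M k R (isLocal_const True)) (hD.members M k R hD.bit) ldec

variable [Nonempty Out]

theorem learnt (hD : IsLocalPlan D) (r : ℕ) :
    IsLocal fun N adv v => (D N adv).learnt j M k R ldec r v :=
  (hD.stored j M k R ldec r).lookup (hD.hostCell j M k) R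

theorem allowed (hD : IsLocalPlan D) (P : LCL In Out) :
    IsLocal fun N adv v => (D N adv).allowed j M k R ldec P v := by
  have h₁ := isLocal_ident.setForall ((hD.cell j M k).prodMk (isLocal_satAt P)) R
    fun (g : ℕ → ℕ → Out) q _ b => b.1 = q → g ∈ b.2
  have h₂ := isLocal_ident.setForall ((hD.bdry j M k P.r).prodMk (isLocal_nbrIds.prodMk
    (isLocal_ident.prodMk (hD.learnt j M k R ldec P.r)))) (R + P.r)
    fun (g : ℕ → ℕ → Out) _ _ b => b.1 → ∀ i ∈ b.2.1, g b.2.2.1 i = b.2.2.2 b.2.2.1 i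
  exact h₁.map₂ h₂ fun S T => S ∩ T

theorem out (hD : IsLocalPlan D) (P : LCL In Out) :
    IsLocal fun N adv v => (D N adv).out j M k R ldec P v :=
  (((hD.allowed j M k R ldec P).map fun S => Classical.epsilon fun g => g ∈ S).lookup
    (hD.cell j M k) R).map₂ isLocal_ident fun g i => g i

end IsLocalPlan

/-- The plan read off from the advice. -/
noncomputable def planOf (s m M : ℕ) (dec : Set ℕ → ℕ × ℕ × Bool) (N : Net In)
    (adv : N.V → List Bool) : Plan N where
  ctr := IsCenter N.graph adv s m
  par := pointer N M (IsCenter N.graph adv s m) fun v => (dec (code N.graph adv s m v)).1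
  host := pointer N M (IsCenter N.graph adv s m) fun v => (dec (code N.graph adv s m v)).2.1
  bit v := IsCenter N.graph adv s m v ∧ (dec (code N.graph adv s m v)).2.2 = true

theorem isLocal_isCenter (s m : ℕ) :
    IsLocal fun (N : Net In) adv v => IsCenter N.graph adv s m v := by
  have h := ((isLocal_ident (In := In)).setForall (isLocal_ident.prodMk isLocal_adv) (s * m)
    fun (_ : Unit) i _ b => b.2 = [true] → b.1 = i).map₂ isLocal_adv fun S a => a = [true] ∧ () ∈ S
  convert h using 4 with N adv v
  constructor
  · rintro ⟨h1, h2⟩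
    exact ⟨h1, fun u hu hb => congrArg _ (h2 u hu hb)⟩
  · rintro ⟨h1, h2⟩
    exact ⟨h1, fun u hu hb => N.ident.injective (h2 u hu hb)⟩

theorem isLocal_code (s m : ℕ) : IsLocal fun (N : Net In) adv v => code N.graph adv s m v := by
  -- The farthest data mark is `j = m`, at distance `s * (m + m)`.
  have h := (isLocal_const ()).setExists (isLocal_adv (In := In)) (s * (m + m))
    fun i _ e b => i ∈ Set.Icc 1 m ∧ b = [true] ∧ e = (s * (m + i) : ℕ)
  convert h using 4 with N adv v
  ext i
  constructor
  · rintro ⟨hi, u, hu, hd⟩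
    refine ⟨u, ?_, hi, hu, hd⟩
    rw [hd]
    exact_mod_cast Nat.mul_le_mul_left s (by have := hi.2; omega)
  · rintro ⟨u, -, hi, hu, hd⟩
    exact ⟨hi, u, hu, hd⟩

theorem isLocalPlan_planOf (s m M : ℕ) (dec : Set ℕ → ℕ × ℕ × Bool) :
    IsLocalPlan (planOf (In := In) s m M dec) where
  ctr := isLocal_isCenter s m
  par := (isLocal_isCenter s m).pointer ((isLocal_code s m).map fun S => (dec S).1) M
  host := (isLocal_isCenter s m).pointer ((isLocal_code s m).map fun S => (dec S).2.1) M
  bit := (isLocal_isCenter s m).map₂ (isLocal_code s m) fun a S => a ∧ (dec S).2.2 = true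

end Decoding

/-! ### Correctness of the decoder -/

section Correctness

variable {In Out : Type} {N : Net In}

/-- The labelling `g` shows that every cell has an allowed labelling, and the nodes of a cell use
the same selection. A node within `r` of `w` but in another cell is a boundary node, where both
selections equal the learnt labels. So the ball around `w` looks as in the selection of the cell of
`w`. -/
theorem Plan.isSolution_out [Nonempty Out] {d : Plan N} {j M k R : ℕ}
    {ldec : Set (ℕ × ℕ) → Set ℕ → Set ℕ → ℕ → ℕ → Out} {P : LCL In Out} {g : ℕ → ℕ → Out}
    (hg : ∀ w, g ∈ satAt P N w)
    (hcell : ∀ v, ∃ q, N.graph.edist v q ≤ (R : ℕ∞) ∧ N.ident q = d.cell j M k v)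
    (hlearnt : ∀ u, d.bdry j M k P.r u → ∀ i ∈ nbrIds N u,
      d.learnt j M k R ldec P.r u (N.ident u) i = g (N.ident u) i) :
    P.IsSolution N.toLGraph fun u v _ => d.out j M k R ldec P u (N.ident v) := by
  intro w
  choose leader hnear hleader using hcell
  let sel : N.V → ℕ → ℕ → Out :=
    fun q => Classical.epsilon fun g => g ∈ d.allowed j M k R ldec P q
  have hsel : ∀ q, sel q ∈ d.allowed j M k R ldec P q := fun q =>
    Classical.epsilon_spec (p := fun g => g ∈ d.allowed j M k R ldec P q)
      ⟨g, fun w _ _ => hg w, fun u _ hu i hi => (hlearnt u hu i hi).symm⟩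
  have hout : ∀ v i, d.out j M k R ldec P v i = sel (leader v) (N.ident v) i := fun v i => by
    rw [Plan.out, lookup_eq (hnear v) (hleader v)]
  have hw : N.graph.edist (leader w) w ≤ (R : ℕ∞) := SimpleGraph.edist_comm.trans_le (hnear w)
  obtain ⟨H, hH, hiso⟩ := (hsel (leader w)).1 w hw (hleader w).symm
  refine ⟨H, hH, rootedIso_ball_congr (fun u v huv hu => ?_) hiso⟩
  rw [hout]
  by_cases hc : d.cell j M k u = d.cell j M k w
  · rw [N.ident.injective ((hleader u).trans (hc.trans (hleader w).symm))]
  · have hu' : N.graph.edist u w ≤ (P.r : ℕ∞) := SimpleGraph.edist_comm.trans_le hu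
    have hb : d.bdry j M k P.r u := ⟨w, hu', Ne.symm hc⟩
    have hv : N.ident v ∈ nbrIds N u := ⟨v, huv, rfl⟩
    rw [(hsel (leader u)).2 u ((SimpleGraph.edist_comm.trans_le (hnear u)).trans
      (by exact_mod_cast Nat.le_add_right R P.r)) hb _ hv]
    refine ((hsel (leader w)).2 u ?_ hb _ hv).symm
    refine SimpleGraph.edist_triangle.trans ((add_le_add hw hu).trans ?_)
    exact_mod_cast le_rfl

/-- The plan `d` has the set `X` of centers, and its pointers are given by `par` and `host`. -/
structure Plan.Realizes (d : Plan N) (j M : ℕ) (X : Finset N.V) (par host : N.V → N.V) : Prop where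
  ctr_iff : ∀ v, d.ctr v ↔ v ∈ X
  cover : ∀ v, (∀ x ∈ X, ¬ N.graph.edist v x ≤ (j : ℕ∞)) → ∀ u, N.graph.edist v u ≠ ⊤ →
    N.graph.edist v u ≤ (j : ℕ∞)
  par_mem : ∀ x ∈ X, par x ∈ X
  par_near : ∀ x ∈ X, N.graph.edist x (par x) ≤ (M : ℕ∞)
  par_eq : ∀ x ∈ X, d.par x = N.ident (par x)
  host_mem : ∀ x ∈ X, host x ∈ X
  host_near : ∀ x ∈ X, N.graph.edist x (host x) ≤ (M : ℕ∞)
  host_eq : ∀ x ∈ X, d.host x = N.ident (host x)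

section WithBit

variable (d : Plan N) (b : N.V → Prop) (j M k R r : ℕ)

/-- Roots, cells and hosts do not read the stored bits, so the bits can be chosen after them. -/
theorem Plan.root_withBit : Plan.root { d with bit := b } M k = d.root M k := by
  induction k with
  | zero => rfl
  | succ k ih => funext v; simp only [Plan.root, ih]

theorem Plan.cell_withBit : Plan.cell { d with bit := b } j M k = d.cell j M k := by
  funext v; simp only [Plan.cell, Plan.root_withBit]; rfl

theorem Plan.bdry_withBit : Plan.bdry { d with bit := b } j M k r = d.bdry j M k r := by
  funext v; simp only [Plan.bdry, Plan.cell_withBit]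

theorem Plan.hostCell_withBit : Plan.hostCell { d with bit := b } j M k = d.hostCell j M k := by
  funext v; simp only [Plan.hostCell, Plan.root_withBit]; rfl

theorem Plan.stored_withBit (ldec : Set (ℕ × ℕ) → Set ℕ → Set ℕ → ℕ → ℕ → Out) (q : N.V) :
    Plan.stored { d with bit := b } j M k R ldec r q = ldec (d.hosted j M k R r q)
      (d.members M k R (fun _ => True) q) (d.members M k R b q) := by
  simp only [Plan.stored, Plan.hosted, Plan.members, Plan.bdry_withBit, Plan.hostCell_withBit,
    Plan.root_withBit]

end WithBit

namespace Plan.Realizes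

variable {d : Plan N} {j M : ℕ} {X : Finset N.V} {par host : N.V → N.V}

theorem edist_iterate (h : d.Realizes j M X par host) (k : ℕ) :
    ∀ x ∈ X, N.graph.edist x (par^[k] x) ≤ (k * M : ℕ) := by
  induction k with
  | zero => simp
  | succ k ih =>
    intro x hx
    refine SimpleGraph.edist_triangle.trans
      ((add_le_add (h.par_near x hx) (ih _ (h.par_mem x hx))).trans ?_)
    norm_cast
    rw [Nat.succ_mul, Nat.add_comm]

theorem root_eq (h : d.Realizes j M X par host) (k : ℕ) :
    ∀ x ∈ X, d.root M k x = N.ident (par^[k] x) := by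
  induction k with
  | zero => exact fun _ _ => rfl
  | succ k ih =>
    intro x hx
    rw [Plan.root, lookup_eq (h.par_near x hx) (h.par_eq x hx).symm, ih _ (h.par_mem x hx)]
    rfl

theorem exists_tile (h : d.Realizes j M X par host) {v : N.V}
    (hv : ∃ x ∈ X, N.graph.edist v x ≤ (j : ℕ∞)) :
    ∃ x ∈ X, N.graph.edist v x ≤ (j : ℕ∞) ∧ N.ident x = d.tile j v := by
  obtain ⟨x, hx, hvx⟩ := hv
  obtain ⟨y, hy, hc, he⟩ : d.tile j v ∈ idsNear N j d.ctr v :=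
    Nat.sInf_mem ⟨_, x, hvx, (h.ctr_iff x).2 hx, rfl⟩
  exact ⟨y, (h.ctr_iff y).1 hc, hy, he⟩

theorem cell_eq_root (h : d.Realizes j M X par host) (k : ℕ) {v x : N.V} (hx : x ∈ X)
    (hvx : N.graph.edist v x ≤ (j : ℕ∞)) (he : N.ident x = d.tile j v) :
    d.cell j M k v = N.ident (par^[k] x) := by
  rw [Plan.cell, if_pos ⟨_, x, hvx, (h.ctr_iff x).2 hx, rfl⟩, lookup_eq hvx he, h.root_eq k x hx]

theorem hostCell_eq_root (h : d.Realizes j M X par host) (k : ℕ) {v x : N.V} (hx : x ∈ X)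
    (hvx : N.graph.edist v x ≤ (j : ℕ∞)) (he : N.ident x = d.tile j v) :
    d.hostCell j M k v = N.ident (par^[k] (host x)) := by
  rw [Plan.hostCell, lookup_eq hvx he, lookup_eq (h.host_near x hx) (h.host_eq x hx).symm,
    h.root_eq k _ (h.host_mem x hx)]

theorem cell_of_not_covered (h : d.Realizes j M X par host) (k : ℕ) {v : N.V}
    (hv : ¬ ∃ x ∈ X, N.graph.edist v x ≤ (j : ℕ∞)) :
    d.cell j M k v = sInf (idsNear N j (fun _ => True) v) := by
  rw [Plan.cell, if_neg]
  rintro ⟨_, x, hvx, hx, -⟩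
  exact hv ⟨x, (h.ctr_iff x).1 hx, hvx⟩

theorem exists_leader (h : d.Realizes j M X par host) (k : ℕ) (v : N.V) :
    ∃ q, N.graph.edist v q ≤ (j + k * M : ℕ) ∧ N.ident q = d.cell j M k v := by
  by_cases hv : ∃ x ∈ X, N.graph.edist v x ≤ (j : ℕ∞)
  · obtain ⟨x, hx, hvx, he⟩ := h.exists_tile hv
    refine ⟨par^[k] x, SimpleGraph.edist_triangle.trans
      ((add_le_add hvx (h.edist_iterate k x hx)).trans (by push_cast; exact le_rfl)),
      (h.cell_eq_root k hx hvx he).symm⟩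
  · rw [h.cell_of_not_covered k hv]
    obtain ⟨q, hq, -, he⟩ : sInf (idsNear N j (fun _ => True) v) ∈ idsNear N j (fun _ => True) v :=
      Nat.sInf_mem ⟨_, v, by simp, trivial, rfl⟩
    exact ⟨q, hq.trans (by exact_mod_cast Nat.le_add_right _ _), he⟩

/-- The component of an uncovered node lies within distance `j` of it and so contains no center. All
its nodes are then uncovered and name the smallest identifier of the component. -/
theorem cell_eq_of_not_covered (h : d.Realizes j M X par host) (k : ℕ) {v u : N.V}
    (hv : ¬ ∃ x ∈ X, N.graph.edist v x ≤ (j : ℕ∞)) (hvu : N.graph.edist v u ≠ ⊤) :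
    d.cell j M k u = d.cell j M k v := by
  have hreach : ∀ w, N.graph.edist v w ≠ ⊤ ↔ N.graph.edist u w ≠ ⊤ := by
    simp only [SimpleGraph.edist_ne_top_iff_reachable] at hvu ⊢
    exact fun w => ⟨hvu.symm.trans, hvu.trans⟩
  have hcov := h.cover v fun x hx hvx => hv ⟨x, hx, hvx⟩
  have hu : ¬ ∃ x ∈ X, N.graph.edist u x ≤ (j : ℕ∞) := by
    rintro ⟨x, hx, hux⟩
    exact hv ⟨x, hx, hcov x ((hreach x).2 (ne_top_of_le_ne_top (ENat.natCast_ne_top j) hux))⟩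
  have hcov' := h.cover u fun x hx hvx => hu ⟨x, hx, hvx⟩
  rw [h.cell_of_not_covered k hv, h.cell_of_not_covered k hu]
  congr 1
  ext i
  constructor
  · rintro ⟨w, hw, -, rfl⟩
    exact ⟨w, hcov w ((hreach w).2 (ne_top_of_le_ne_top (ENat.natCast_ne_top j) hw)), trivial, rfl⟩
  · rintro ⟨w, hw, -, rfl⟩
    exact ⟨w, hcov' w ((hreach w).1 (ne_top_of_le_ne_top (ENat.natCast_ne_top j) hw)), trivial, rfl⟩

/-- A component with an uncovered node is a single cell, so `u` and the nearby node of another cell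
both lie in tiles. Their centers are at distance at most `j + r + j ≤ M`. -/
theorem exists_tile_of_bdry (h : d.Realizes j M X par host) {k r : ℕ} (hr : 2 * j + r ≤ M)
    {u : N.V} (hu : d.bdry j M k r u) :
    ∃ x ∈ X, N.graph.edist u x ≤ (j : ℕ∞) ∧ N.ident x = d.tile j u ∧
      ∃ y ∈ X, N.graph.edist x y ≤ (M : ℕ∞) ∧ par^[k] y ≠ par^[k] x := by
  obtain ⟨u', huu', hne⟩ := hu
  have hfin : N.graph.edist u u' ≠ ⊤ := ne_top_of_le_ne_top (ENat.natCast_ne_top r) huu'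
  obtain ⟨x, hx, hux, he⟩ := h.exists_tile (v := u) (by
    by_contra hcon
    exact hne (h.cell_eq_of_not_covered k hcon hfin))
  obtain ⟨y, hy, huy, he'⟩ := h.exists_tile (v := u') (by
    by_contra hcon
    exact hne (h.cell_eq_of_not_covered k hcon (by rwa [SimpleGraph.edist_comm])).symm)
  refine ⟨x, hx, hux, he, y, hy, ?_, fun hxy => hne ?_⟩
  · have h1 : N.graph.edist x y ≤ j + (r + j) := SimpleGraph.edist_triangle.trans
      (add_le_add (SimpleGraph.edist_comm.trans_le hux)
        (SimpleGraph.edist_triangle.trans (add_le_add huu' huy)))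
    refine h1.trans ?_
    norm_cast
    omega
  · rw [h.cell_eq_root k hx hux he, h.cell_eq_root k hy huy he', hxy]

open scoped Classical in
/-- The number of labels stored by a cell is bounded in terms of the number of tiles hosted by
it. -/
theorem ncard_hosted_le (h : d.Realizes j M X par host) {k r R L : ℕ} (hr : 2 * j + r ≤ M)
    (hL : ∀ x, {p : ℕ × ℕ | ∃ u w, N.graph.edist x u ≤ (j : ℕ∞) ∧ N.graph.Adj u w ∧
      p = (N.ident u, N.ident w)}.ncard ≤ L) (q : N.V) :
    (d.hosted j M k R r q).Finite ∧ (d.hosted j M k R r q).ncard ≤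
      L * (X.filter fun x => (∃ y ∈ X, N.graph.edist x y ≤ (M : ℕ∞) ∧ par^[k] y ≠ par^[k] x) ∧
        par^[k] (host x) = q).card := by
  set F := X.filter fun x => (∃ y ∈ X, N.graph.edist x y ≤ (M : ℕ∞) ∧ par^[k] y ≠ par^[k] x) ∧
        par^[k] (host x) = q
  have hfin : ∀ x, {p : ℕ × ℕ | ∃ u w, N.graph.edist x u ≤ (j : ℕ∞) ∧ N.graph.Adj u w ∧
      p = (N.ident u, N.ident w)}.Finite := fun x => by
    refine (Set.finite_range fun uw : N.V × N.V => (N.ident uw.1, N.ident uw.2)).subset ?_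
    rintro _ ⟨u, w, -, -, rfl⟩
    exact ⟨(u, w), rfl⟩
  have hsub : d.hosted j M k R r q ⊆ (F.biUnion fun x => (hfin x).toFinset : Finset (ℕ × ℕ)) := by
    rintro ⟨a, b⟩ ⟨u, -, hu, hq, rfl : a = _, w, hw, rfl : _ = b⟩
    obtain ⟨x, hx, hux, he, hy⟩ := h.exists_tile_of_bdry hr hu
    rw [h.hostCell_eq_root k hx hux he] at hq
    rw [Finset.mem_coe, Finset.mem_biUnion]
    refine ⟨x, Finset.mem_filter.2 ⟨hx, hy, N.ident.injective hq⟩, ?_⟩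
    rw [Set.Finite.mem_toFinset]
    exact ⟨u, w, SimpleGraph.edist_comm.trans_le hux, hw, rfl⟩
  refine ⟨(Finset.finite_toSet _).subset hsub, ?_⟩
  refine (Set.ncard_le_ncard hsub (Finset.finite_toSet _)).trans ?_
  rw [Set.ncard_coe_finset, mul_comm]
  refine Finset.card_biUnion_le_card_mul _ _ _ fun x _ => ?_
  rw [← Set.ncard_eq_toFinset_card _ (hfin x)]
  exact hL x

-- The labels hosted by a cell are encoded as a subset of its centers, and the bit of a center tells
-- whether it belongs to that subset. By `hcount` there are at least `c * L` centers for every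
-- hosted tile, enough for its at most `L` labels of `c` bits.
open scoped Classical in
theorem exists_bit [Nonempty Out] (h : d.Realizes j M X par host) {k R L c : ℕ} {P : LCL In Out}
    (hr : 2 * j + P.r ≤ M) (hR : j + M + k * M ≤ R)
    (hL : ∀ x, {p : ℕ × ℕ | ∃ u w, N.graph.edist x u ≤ (j : ℕ∞) ∧ N.graph.Adj u w ∧
      p = (N.ident u, N.ident w)}.ncard ≤ L)
    (hc : Nat.card Out ≤ 2 ^ c)
    (hcount : ∀ q, c * L * (X.filter fun x => (∃ y ∈ X, N.graph.edist x y ≤ (M : ℕ∞) ∧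
      par^[k] y ≠ par^[k] x) ∧ par^[k] (host x) = q).card ≤
      (X.filter fun x => par^[k] x = q).card)
    {ldec : Set (ℕ × ℕ) → Set ℕ → Set ℕ → ℕ → ℕ → Out}
    (hldec : ∀ A B, A.Finite → B.Finite → ∀ c, Nat.card Out ≤ 2 ^ c →
      c * A.ncard ≤ B.ncard → ∀ g : ℕ → ℕ → Out, ∃ S ⊆ B, ∀ p ∈ A, ldec A B S p.1 p.2 = g p.1 p.2)
    {g : ℕ → ℕ → Out} (hg : ∀ w, g ∈ satAt P N w) :
    ∃ bit : N.V → Bool, P.IsSolution N.toLGraph fun u v _ =>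
      Plan.out { d with bit := fun v => v ∈ X ∧ bit v = true } j M k R ldec P u (N.ident v) := by
  have hmem : ∀ q, d.members M k R (fun _ => True) q =
      N.ident '' (X.filter fun x => par^[k] x = q : Finset N.V) := by
    intro q
    ext i
    constructor
    · rintro ⟨x, -, hx, hroot, -, rfl⟩
      have hx' := (h.ctr_iff x).1 hx
      rw [h.root_eq k x hx'] at hroot
      exact ⟨x, Finset.mem_coe.2 (Finset.mem_filter.2 ⟨hx', N.ident.injective hroot⟩), rfl⟩
    · rintro ⟨x, hx, rfl⟩
      obtain ⟨hxX, rfl⟩ := Finset.mem_filter.1 (Finset.mem_coe.1 hx)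
      refine ⟨x, ?_, (h.ctr_iff x).2 hxX, h.root_eq k x hxX, trivial, rfl⟩
      rw [SimpleGraph.edist_comm]
      refine (h.edist_iterate k x hxX).trans ?_
      exact_mod_cast (Nat.le_add_left _ _).trans hR
  have hS : ∀ q, ∃ S ⊆ d.members M k R (fun _ => True) q,
      ∀ p ∈ d.hosted j M k R P.r q, ldec (d.hosted j M k R P.r q)
        (d.members M k R (fun _ => True) q) S p.1 p.2 = g p.1 p.2 := by
    intro q
    obtain ⟨hfin, hle⟩ := h.ncard_hosted_le (k := k) (R := R) hr hL q
    refine hldec _ _ hfin ?_ c hc ?_ g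
    · rw [hmem]
      exact (Finset.finite_toSet _).image _
    · rw [hmem, Set.ncard_image_of_injective _ N.ident.injective, Set.ncard_coe_finset]
      refine (Nat.mul_le_mul_left c hle).trans ?_
      rw [← mul_assoc]
      exact hcount q
  choose S hSsub hSdec using hS
  let bit : N.V → Bool := fun x => decide (N.ident x ∈ S (par^[k] x))
  have hbits : ∀ q, d.members M k R (fun v => v ∈ X ∧ bit v = true) q = S q := by
    intro q
    ext i
    constructor
    · rintro ⟨x, -, hx, hroot, hb, rfl⟩
      rw [h.root_eq k x hb.1] at hroot
      have := N.ident.injective hroot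
      simpa [bit, this] using hb.2
    · intro hi
      obtain ⟨x, hqx, hx, hroot, -, rfl⟩ := hSsub q hi
      have hx' := (h.ctr_iff x).1 hx
      refine ⟨x, hqx, hx, hroot, ⟨hx', ?_⟩, rfl⟩
      rw [h.root_eq k x hx'] at hroot
      have := N.ident.injective hroot
      simpa [bit, this] using hi
  refine ⟨bit, Plan.isSolution_out hg (fun v => ?_) fun u hu i hi => ?_⟩
  · obtain ⟨q, hq, he⟩ := h.exists_leader k v
    rw [Plan.cell_withBit]
    refine ⟨q, hq.trans ?_, he⟩
    norm_cast
    omega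
  · have hu' : d.bdry j M k P.r u := by rwa [Plan.bdry_withBit] at hu
    obtain ⟨x, hx, hux, he, -⟩ := h.exists_tile_of_bdry hr hu'
    set q := par^[k] (host x) with hq
    have hcell : d.hostCell j M k u = N.ident q := h.hostCell_eq_root k hx hux he
    -- The route leads from `u` to its center, on to the host and along `k` parents: `j + M + k *
    -- M`.
    have huq : N.graph.edist u q ≤ (R : ℕ∞) := by
      refine (SimpleGraph.edist_triangle.trans (add_le_add hux (SimpleGraph.edist_triangle.trans
        (add_le_add (h.host_near x hx) (h.edist_iterate k _ (h.host_mem x hx)))))).trans ?_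
      norm_cast
      omega
    have hlearn : Plan.learnt { d with bit := fun v => v ∈ X ∧ bit v = true } j M k R ldec P.r u =
        ldec (d.hosted j M k R P.r q) (d.members M k R (fun _ => True) q)
          (d.members M k R (fun v => v ∈ X ∧ bit v = true) q) := by
      rw [Plan.learnt, Plan.hostCell_withBit, lookup_eq huq hcell.symm, Plan.stored_withBit]
    rw [hlearn, hbits]
    exact hSdec q (N.ident u, i)
      ⟨u, SimpleGraph.edist_comm.trans_le huq, hu', hcell, rfl, hi⟩

end Plan.Realizes

end Correctness

/-! ### Maximal packings of centers -/

section Packing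

variable {V : Type} {G : SimpleGraph V}

/-- There is a maximal set of nodes of eccentricity at least `ρ` that are far from each other. -/
theorem exists_packing [Finite V] (G : SimpleGraph V) (ρ : ℕ) : ∃ X : Finset V,
    (∀ x ∈ X, ∃ u, G.edist x u = (ρ : ℕ∞)) ∧
    (∀ x ∈ X, ∀ y ∈ X, x ≠ y → ((3 * ρ : ℕ) : ℕ∞) < G.edist x y) ∧
    ∀ v, (∀ x ∈ X, ¬ G.edist v x ≤ (3 * ρ : ℕ)) → ∀ u, G.edist v u ≠ ⊤ →
      G.edist v u ≤ (3 * ρ : ℕ) := by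
  classical
  obtain ⟨X, hX⟩ := (Set.toFinite {X : Finset V | (∀ x ∈ X, ∃ u, G.edist x u = (ρ : ℕ∞)) ∧
    ∀ x ∈ X, ∀ y ∈ X, x ≠ y → ((3 * ρ : ℕ) : ℕ∞) < G.edist x y}).exists_maximal ⟨∅, by simp⟩
  refine ⟨X, hX.prop.1, hX.prop.2, fun v hv u hfin => ?_⟩
  by_contra! hlt
  have hvX : v ∉ X := fun h => hv v h (by simp)
  refine hvX (hX.le_of_ge (y := insert v X) ⟨?_, ?_⟩ (Finset.subset_insert v X)
    (Finset.mem_insert_self v X))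
  · intro x hx
    obtain rfl | hx := Finset.mem_insert.1 hx
    -- A geodesic from the new node of length more than `3ρ` passes a node at distance exactly `ρ`.
    · obtain ⟨e, he⟩ := ENat.ne_top_iff_exists.1 hfin
      obtain ⟨p, hp0, hp⟩ := exists_geodesic he.symm
      rw [← he] at hlt
      have hlt' : 3 * ρ < e := by exact_mod_cast hlt
      exact ⟨p (0 + ρ), by have := hp 0 ρ (by omega); rwa [hp0] at this⟩
    · exact hX.prop.1 x hx
  · intro x hx y hy hxy
    obtain rfl | hx' := Finset.mem_insert.1 hx <;> obtain rfl | hy' := Finset.mem_insert.1 hy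
    · exact absurd rfl hxy
    · exact not_le.1 (hv y hy')
    · rw [SimpleGraph.edist_comm]
      exact not_le.1 (hv x hx')
    · exact hX.prop.2 x hx' y hy' hxy

theorem bfs_subset_ball {M : ℕ} {U : Finset V} {x : V} (k : ℕ) :
    ∀ y ∈ bfs (fun x y => G.edist x y ≤ (M : ℕ∞)) U x k, G.edist x y ≤ (k * M : ℕ) := by
  induction k with
  | zero => simp [bfs]
  | succ k ih =>
    intro y hy
    obtain ⟨-, z, hz, hzy⟩ := mem_bfs_succ.1 hy
    refine SimpleGraph.edist_triangle.trans ((add_le_add (ih z hz) hzy).trans ?_)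
    norm_cast
    rw [Nat.succ_mul]

end Packing

/-! ### The encoder on one graph -/

section Instances

variable {In Out : Type}

theorem card_le_of_forall_edist_le {G : LGraph In} {v : G.V} {d D : ℕ}
    (h : (G.nbhd v d).ncard ≤ D) (S : Finset G.V)
    (hS : ∀ u ∈ S, G.graph.edist v u ≤ (d : ℕ∞)) : S.card ≤ D := by
  rw [← Set.ncard_coe_finset]
  exact (Set.ncard_le_ncard (fun u hu => hS u hu) (Set.toFinite _)).trans h

theorem ncard_edges_le {N : Net In} {Δ D j : ℕ} (hΔ : N.maxDeg ≤ Δ) {x : N.V}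
    (hD : (N.nbhd x j).ncard ≤ D) : {p : ℕ × ℕ | ∃ u w, N.graph.edist x u ≤ (j : ℕ∞) ∧
      N.graph.Adj u w ∧ p = (N.ident u, N.ident w)}.ncard ≤ D * Δ := by
  classical
  set S : Finset N.V := Finset.univ.filter fun u => N.graph.edist x u ≤ (j : ℕ∞)
  have hsub : {p : ℕ × ℕ | ∃ u w, N.graph.edist x u ≤ (j : ℕ∞) ∧
      N.graph.Adj u w ∧ p = (N.ident u, N.ident w)} ⊆ (S.biUnion fun u =>
        (N.graph.neighborFinset u).image fun w => (N.ident u, N.ident w) : Finset (ℕ × ℕ)) := by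
    rintro _ ⟨u, w, hu, hw, rfl⟩
    rw [Finset.mem_coe, Finset.mem_biUnion]
    exact ⟨u, Finset.mem_filter.2 ⟨Finset.mem_univ _, hu⟩,
      Finset.mem_image_of_mem _ ((N.graph.mem_neighborFinset u w).2 hw)⟩
  refine (Set.ncard_le_ncard hsub (Finset.finite_toSet _)).trans ?_
  rw [Set.ncard_coe_finset]
  refine (Finset.card_biUnion_le_card_mul _ _ Δ fun u _ => ?_).trans
    (Nat.mul_le_mul_right _ (card_le_of_forall_edist_le hD S
      fun u hu => (Finset.mem_filter.1 hu).2))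
  refine Finset.card_image_le.trans (le_trans ?_ hΔ)
  rw [SimpleGraph.card_neighborFinset_eq_degree]
  refine (N.graph.degree_le_maxDegree u).trans_eq ?_
  unfold LGraph.maxDeg
  congr!

/-- Injectivity of identifiers makes this well defined; pairs that are not edges get an arbitrary
label. -/
theorem exists_idLabel [Nonempty Out] {P : LCL In Out} (N : Net In)
    (h : ∃ ℓ : ∀ u v : N.V, N.graph.Adj u v → Out, P.IsSolution N.toLGraph ℓ) :
    ∃ g : ℕ → ℕ → Out, ∀ w, g ∈ satAt P N w := by
  obtain ⟨ℓ, hℓ⟩ := h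
  have hex : ∀ i j, ∃ o : Out, ∀ u v (h : N.graph.Adj u v), N.ident u = i → N.ident v = j →
      o = ℓ u v h := by
    intro i j
    by_cases h : ∃ u v, N.graph.Adj u v ∧ N.ident u = i ∧ N.ident v = j
    · obtain ⟨u, v, huv, rfl, rfl⟩ := h
      refine ⟨ℓ u v huv, fun u' v' h' hu hv => ?_⟩
      obtain rfl := N.ident.injective hu
      obtain rfl := N.ident.injective hv
      rfl
    · exact ⟨Classical.arbitrary _, fun u v huv hu hv => absurd ⟨u, v, huv, hu, hv⟩ h⟩
  choose g hg using hex
  refine ⟨g, fun w => ?_⟩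
  obtain ⟨H, hH, hiso⟩ := hℓ w
  exact ⟨H, hH, rootedIso_ball_congr (fun u v huv _ => hg _ _ u v huv rfl rfl) hiso⟩

/-- A pointer is a rank among the identifiers of the nearby centers, so it is smaller than the size
of the ball. -/
theorem exists_index {N : Net In} {M D : ℕ} {p : N.V → Prop} {x y : N.V}
    (hD : (N.nbhd x M).ncard ≤ D) (hxy : N.graph.edist x y ≤ (M : ℕ∞)) (hy : p y) :
    ∃ i < D, Nat.nth (· ∈ idsNear N M p x) i = N.ident y := by
  have hfin : (Set.ofPred (· ∈ idsNear N M p x)).Finite :=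
    (Set.finite_range N.ident).subset (by rintro _ ⟨u, -, -, rfl⟩; exact ⟨u, rfl⟩)
  obtain ⟨i, hi, he⟩ := Nat.exists_lt_card_finite_nth_eq hfin (x := N.ident y) ⟨y, hxy, hy, rfl⟩
  refine ⟨i, hi.trans_le ?_, he⟩
  rw [← Set.ncard_eq_toFinset_card _ hfin]
  refine le_trans ?_ hD
  rw [← Set.ncard_image_of_injective _ N.ident.injective]
  refine Set.ncard_le_ncard ?_ ((Set.toFinite _).image _)
  rintro _ ⟨u, hu, -, rfl⟩
  exact ⟨u, hu, rfl⟩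

/-- Sparse advice from which the decoder recovers a solution, on one graph. -/
theorem exists_advice [Finite Out] [Nonempty Out] {P : LCL In Out} {s m ρ M k R c D Δ : ℕ}
    (hs : 0 < s) (hm : 0 < m) (hρ : ρ = 2 * s * (m + 1)) (hM : M = 8 * ρ) (hr : P.r ≤ 2 * ρ)
    (hR : 3 * ρ + M + k * M ≤ R) (hc : Nat.card Out ≤ 2 ^ c)
    {dec : Set ℕ → ℕ × ℕ × Bool}
    (hdec : ∀ i < D, ∀ j < D, ∀ b, ∃ S ⊆ Set.Icc 1 m, dec S = (i, j, b))
    {ldec : Set (ℕ × ℕ) → Set ℕ → Set ℕ → ℕ → ℕ → Out}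
    (hldec : ∀ A B, A.Finite → B.Finite → ∀ c, Nat.card Out ≤ 2 ^ c →
      c * A.ncard ≤ B.ncard → ∀ g : ℕ → ℕ → Out, ∃ S ⊆ B, ∀ p ∈ A, ldec A B S p.1 p.2 = g p.1 p.2)
    (N : Net In) (hΔ : N.maxDeg ≤ Δ) (hD : ∀ x, (N.nbhd x M).ncard ≤ D)
    (hgrow : ∀ x, (N.nbhd x (k * M)).ncard * (c * (D * Δ) * (D + 1)) ^ k <
      (c * (D * Δ) * (D + 1) + 1) ^ k)
    (hsol : ∃ ℓ : ∀ u v : N.V, N.graph.Adj u v → Out, P.IsSolution N.toLGraph ℓ) :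
    ∃ adv : N.V → List Bool, (∀ v, adv v = [true] ∨ adv v = [false]) ∧
      s * {v | adv v = [true]}.ncard ≤ Fintype.card N.V ∧
      P.IsSolution N.toLGraph fun u v _ =>
        (planOf s m M dec N adv).out (3 * ρ) M k R ldec P u (N.ident v) := by
  classical
  obtain ⟨X, hecc, hsep, hcover⟩ := exists_packing N.graph ρ
  obtain ⟨par, host, hpar, hhost, hcount⟩ := exists_carving_finset (N := c * (D * Δ)) (D := D)
    (k := k) (E := fun x y => N.graph.edist x y ≤ (M : ℕ∞)) (by simp)
    (fun x y h => SimpleGraph.edist_comm.trans_le h)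
    (fun x S hS => card_le_of_forall_edist_le (hD x) S hS)
    (fun U x _ => (Nat.mul_le_mul_right _ (card_le_of_forall_edist_le le_rfl _
      (bfs_subset_ball k))).trans_lt (hgrow x)) X
  let d : Plan N :=
    { ctr := fun v => v ∈ X
      par := fun v => if v ∈ X then N.ident (par v) else 0
      host := fun v => if v ∈ X then N.ident (host v) else 0
      bit := fun _ => False }
  have hd : d.Realizes (3 * ρ) M X par host :=
    { ctr_iff := fun _ => Iff.rfl
      cover := hcover
      par_mem := fun x hx => (hpar x hx).1
      par_near := fun x hx => (hpar x hx).2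
      par_eq := fun x hx => if_pos hx
      host_mem := fun x hx => (hhost x hx).1
      host_near := fun x hx => (hhost x hx).2
      host_eq := fun x hx => if_pos hx }
  obtain ⟨g, hg⟩ := exists_idLabel N hsol
  have hD3 : ∀ x, (N.nbhd x (3 * ρ)).ncard ≤ D := fun x => by
    refine (Set.ncard_le_ncard (s := N.nbhd x (3 * ρ)) (t := N.nbhd x M)
      (fun u hu => (show N.graph.edist x u ≤ ((3 * ρ : ℕ) : ℕ∞) from hu).trans ?_)
      (Set.toFinite _)).trans (hD x)
    exact_mod_cast (by omega : 3 * ρ ≤ M)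
  -- The first condition reads `2 * (3 * ρ) + P.r ≤ 8 * ρ`, whence the choice of `M`.
  obtain ⟨bit, hbit⟩ := hd.exists_bit (k := k) (L := D * Δ) (by omega) hR
    (fun x => ncard_edges_le hΔ (hD3 x)) hc (fun q => by convert hcount q) hldec hg
  have hJ : ∀ x, ∃ J ⊆ Set.Icc 1 m, x ∈ X →
      Nat.nth (· ∈ idsNear N M (fun v => v ∈ X) x) (dec J).1 = N.ident (par x) ∧
      Nat.nth (· ∈ idsNear N M (fun v => v ∈ X) x) (dec J).2.1 = N.ident (host x) ∧
      (dec J).2.2 = bit x := by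
    intro x
    by_cases hx : x ∈ X
    · obtain ⟨i, hi, hip⟩ := exists_index (hD x) (hpar x hx).2 (p := fun v => v ∈ X) (hpar x hx).1
      obtain ⟨i', hi', hih⟩ := exists_index (hD x) (hhost x hx).2 (p := fun v => v ∈ X)
        (hhost x hx).1
      obtain ⟨J, hJ, he⟩ := hdec i hi i' hi' (bit x)
      refine ⟨J, hJ, fun _ => ?_⟩
      rw [he]
      exact ⟨hip, hih, rfl⟩
    · exact ⟨∅, Set.empty_subset _, fun h => absurd h hx⟩
  choose J hJm hJ using hJ
  obtain ⟨adv, hadv, hsparse, hctr, hcode⟩ := exists_beacons (G := N.graph) hs hm X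
    (by rwa [hρ] at hsep) (by rwa [hρ] at hecc) J hJm
  refine ⟨adv, hadv, hsparse, ?_⟩
  have hctr' : IsCenter N.graph adv s m = fun v => v ∈ X := funext fun v => propext (hctr v)
  have hplan : planOf s m M dec N adv =
      { d with bit := fun v => v ∈ X ∧ bit v = true } := by
    unfold planOf
    rw [hctr']
    congr 1
    · funext v
      by_cases hv : v ∈ X
      · simp only [pointer, d, if_pos hv, hcode v hv, (hJ v hv).1]
      · simp only [pointer, d, if_neg hv]
    · funext v
      by_cases hv : v ∈ X
      · simp only [pointer, d, if_pos hv, hcode v hv, (hJ v hv).2.1]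
      · simp only [pointer, d, if_neg hv]
    · funext v
      by_cases hv : v ∈ X
      · simp only [hcode v hv, (hJ v hv).2.2]
      · simp only [hv, false_and]
  rw [hplan]
  exact hbit

end Instances

/-! ### Constants from sub-exponential growth -/

section Growth

variable {In : Type}

theorem SubexpGrowth.exists_ball_bound {𝒢 : Set (LGraph In)} (h : SubexpGrowth 𝒢) {M : ℕ}
    (hM : 0 < M) (K : ℕ) : ∃ k : ℕ, ∀ G ∈ 𝒢, ∀ v : G.V,
      (G.nbhd v (k * M)).ncard * K ^ k < (K + 1) ^ k := by
  -- A base `t > 1` with `t * K < K + 1`, valid also for `K = 0`. The growth rate `logb 2 t / M`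
  -- bounds balls of radius `k * M` by `t ^ k`; the exponent `k = x₀ + 1` is nonzero, as strictness
  -- requires.
  set t : ℝ := (K + 1) / (K + 1 / 2) with ht
  have hK : (0 : ℝ) ≤ K := Nat.cast_nonneg K
  have ht1 : 1 < t := by rw [ht, one_lt_div (by positivity)]; linarith
  have hM' : (0 : ℝ) < M := by exact_mod_cast hM
  obtain ⟨x₀, hx₀⟩ := h (Real.logb 2 t / M) (div_pos (Real.logb_pos (by norm_num) ht1) hM')
  refine ⟨x₀ + 1, fun G hG v => ?_⟩
  have h1 := hx₀ ((x₀ + 1) * M) (by nlinarith) G hG v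
  have h2 : Real.logb 2 t / M * (((x₀ + 1) * M : ℕ) : ℝ) = Real.logb 2 t * ((x₀ + 1 : ℕ) : ℝ) := by
    push_cast
    field_simp
  rw [h2, Real.rpow_mul (by norm_num), Real.rpow_logb (by norm_num) (by norm_num) (by linarith),
    Real.rpow_natCast] at h1
  have h3 : t * K < K + 1 := by
    rw [ht, div_mul_eq_mul_div, div_lt_iff₀ (by positivity)]
    nlinarith
  have h4 : ((G.nbhd v ((x₀ + 1) * M)).ncard : ℝ) * (K : ℝ) ^ (x₀ + 1) < (K + 1 : ℝ) ^ (x₀ + 1) :=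
    calc _ ≤ t ^ (x₀ + 1) * (K : ℝ) ^ (x₀ + 1) := by gcongr
      _ = (t * K) ^ (x₀ + 1) := (mul_pow _ _ _).symm
      _ < _ := pow_lt_pow_left₀ h3 (by positivity) (by omega)
  exact_mod_cast h4

/-- The capacity `m` is linear in the radius, while the logarithm of the ball size is sublinear, so
two pointers eventually fit. -/
theorem SubexpGrowth.exists_scale {𝒢 : Set (LGraph In)} (h : SubexpGrowth 𝒢) {s : ℕ} (hs : 0 < s)
    (r : ℕ) : ∃ m D : ℕ, 0 < m ∧ r ≤ 2 * (2 * s * (m + 1)) ∧ 2 * D ^ 2 ≤ 2 ^ m ∧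
      ∀ G ∈ 𝒢, ∀ v : G.V, (G.nbhd v (8 * (2 * s * (m + 1)))).ncard ≤ D := by
  have hs' : (0 : ℝ) < s := by exact_mod_cast hs
  obtain ⟨x₀, hx₀⟩ := h (1 / (64 * s)) (by positivity)
  -- For `m = 4κ + 3` the radius is `64 * s * (κ + 1)`, so balls have at most `D = 2 ^ (κ + 1)`
  -- nodes, and `2 * D ^ 2 = 2 ^ (2κ + 3) ≤ 2 ^ m`. The summands of `κ` make the radius at least
  -- `x₀` and satisfy the bound on `r`.
  set κ := x₀ + r with hκ
  refine ⟨4 * κ + 3, 2 ^ (κ + 1), by omega, by nlinarith, ?_, fun G hG v => ?_⟩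
  · rw [← pow_mul, ← pow_succ']
    exact Nat.pow_le_pow_right (by norm_num) (by omega)
  · have h1 := hx₀ (8 * (2 * s * (4 * κ + 3 + 1))) (by nlinarith) G hG v
    have h2 : 1 / (64 * (s : ℝ)) * ((8 * (2 * s * (4 * κ + 3 + 1)) : ℕ) : ℝ) =
        ((κ + 1 : ℕ) : ℝ) := by
      push_cast
      field_simp
      ring
    rw [h2, Real.rpow_natCast] at h1
    exact_mod_cast h1

end Growth

/-! ### Assembling the schema -/

section Schema

variable {In Out : Type}

/-- Sparse one-bit advice for which a local decoder produces a solution is a sparse schema. -/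
theorem exists_schema_of_decoder {𝒢 : Set (LGraph In)} {P : LCL In Out} {ε : ℝ} {s T : ℕ}
    (hsε : 1 / ε ≤ s) (hε : 0 < ε) (A : LocalAlgorithm In Out)
    (h : ∀ G ∈ 𝒢, ∀ ident : G.V ↪ ℕ, ∃ adv : G.V → List Bool,
      (∀ v, adv v = [true] ∨ adv v = [false]) ∧
      s * {v | adv v = [true]}.ncard ≤ Fintype.card G.V ∧
      ∀ p : PortNumbering G, ∃ ℓ : ∀ u v : G.V, G.graph.Adj u v → Out,
        P.IsSolution G ℓ ∧ A.Produces G ident p adv T ℓ) :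
    ∃ f : AdviceMap In, IsAdviceSchema 𝒢 P (fun _ => 1) (fun _ => T) f ∧
      IsUniformFixedLength 𝒢 f ∧ IsEpsSparse 𝒢 ε f := by
  classical
  have hf : ∀ (G : LGraph In) (ident : G.V ↪ ℕ), ∃ adv : G.V → List Bool, G ∈ 𝒢 →
      (∀ v, adv v = [true] ∨ adv v = [false]) ∧
      s * {v | adv v = [true]}.ncard ≤ Fintype.card G.V ∧
      ∀ p : PortNumbering G, ∃ ℓ : ∀ u v : G.V, G.graph.Adj u v → Out,
        P.IsSolution G ℓ ∧ A.Produces G ident p adv T ℓ := fun G ident => by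
    by_cases hG : G ∈ 𝒢
    · obtain ⟨adv, hadv⟩ := h G hG ident
      exact ⟨adv, fun _ => hadv⟩
    · exact ⟨fun _ => [], fun h => absurd h hG⟩
  choose f hf using hf
  have hlen : ∀ G ∈ 𝒢, ∀ (ident : G.V ↪ ℕ) (v : G.V), (f G ident v).length = 1 := by
    intro G hG ident v
    obtain h | h := (hf G ident hG).1 v <;> simp [h]
  refine ⟨f, ⟨fun G hG ident v => (hlen G hG ident v).le, A, fun G hG ident p =>
    (hf G ident hG).2.2 p⟩, fun G hG ident u v => (hlen G hG ident u).trans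
      (hlen G hG ident v).symm, fun G hG ident => ⟨hlen G hG ident, ?_⟩⟩
  obtain ⟨hbit, hsparse, -⟩ := hf G ident hG
  have hcompl : {v | f G ident v = [false]} = {v | f G ident v = [true]}ᶜ := by
    ext v
    change f G ident v = [false] ↔ ¬ f G ident v = [true]
    obtain h | h := hbit v <;> simp [h]
  have hsum := Set.ncard_add_ncard_compl {v | f G ident v = [true]}
  rw [hcompl]
  rw [Nat.card_eq_fintype_card, add_comm] at hsum
  have hsum' : ({v | f G ident v = [true]}ᶜ.ncard : ℝ) + ({v | f G ident v = [true]}.ncard : ℝ) =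
      Fintype.card G.V := by exact_mod_cast hsum
  rw [hsum']
  refine div_le_of_le_mul₀ (Nat.cast_nonneg _) hε.le ?_
  have h1 : (s : ℝ) * ({v | f G ident v = [true]}.ncard : ℝ) ≤ Fintype.card G.V := by
    exact_mod_cast hsparse
  have h2 : 1 ≤ ε * s := by rwa [div_le_iff₀' hε] at hsε
  calc ({v | f G ident v = [true]}.ncard : ℝ)
      ≤ ε * s * ({v | f G ident v = [true]}.ncard : ℝ) :=
        le_mul_of_one_le_left (Nat.cast_nonneg _) h2
    _ = ε * (s * ({v | f G ident v = [true]}.ncard : ℝ)) := mul_assoc _ _ _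
    _ ≤ ε * Fintype.card G.V := by gcongr

theorem exists_sparse_schema [Finite Out] {P : LCL In Out} {Δ : ℕ} {𝒢 : Set (LGraph In)}
    (hΔ : ∀ G ∈ 𝒢, G.maxDeg ≤ Δ) (hgrowth : SubexpGrowth 𝒢)
    (hsolvable : ∀ G ∈ 𝒢, ∃ ℓ : ∀ u v : G.V, G.graph.Adj u v → Out, P.IsSolution G ℓ)
    {ε : ℝ} (hε : 0 < ε) : ∃ (T : ℕ) (f : AdviceMap In),
      IsAdviceSchema 𝒢 P (fun _ => 1) (fun _ => T) f ∧
      IsUniformFixedLength 𝒢 f ∧ IsEpsSparse 𝒢 ε f := by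
  obtain ⟨s, hsε⟩ := exists_nat_ge (1 / ε)
  have hs : 0 < s := by
    have : (0 : ℝ) < s := (one_div_pos.2 hε).trans_le hsε
    exact_mod_cast this
  obtain hOut | hOut := isEmpty_or_nonempty Out
  -- Without output labels, solvability leaves only graphs without edges, and a silent algorithm is
  -- correct.
  · refine ⟨0, exists_schema_of_decoder hsε hε
      { State := Unit, Msg := Unit, init := fun _ _ _ _ _ _ => (), send := fun _ _ => (),
        receive := fun _ _ _ => (), output := fun _ _ => none } fun G hG ident =>
      ⟨fun _ => [false], fun _ => Or.inr rfl, by simp, fun p => ?_⟩⟩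
    obtain ⟨ℓ, hℓ⟩ := hsolvable G hG
    exact ⟨ℓ, hℓ, fun u v h => isEmptyElim (ℓ u v h)⟩
  · obtain ⟨m, D, hm, hr, hmD, hD⟩ := hgrowth.exists_scale hs P.r
    set ρ := 2 * s * (m + 1) with hρ
    have hρ0 : 0 < 8 * ρ := by positivity
    set c := Nat.card Out
    -- A boundary tile carries at most `D * Δ` labels of `c` bits; the factor `D + 1` is the loss in
    -- the carving.
    obtain ⟨k, hk⟩ := hgrowth.exists_ball_bound hρ0 (c * (D * Δ) * (D + 1))
    obtain ⟨dec, hdec⟩ := exists_pointer_decoder hmD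
    obtain ⟨ldec, hldec⟩ := exists_label_decoder Out
    obtain ⟨T, A, hA⟩ := ((isLocalPlan_planOf (In := In) s m (8 * ρ) dec).out (3 * ρ) (8 * ρ) k
      (3 * ρ + 8 * ρ + k * (8 * ρ)) ldec P).exists_algorithm
    refine ⟨T, exists_schema_of_decoder hsε hε A fun G hG ident => ?_⟩
    obtain ⟨adv, hadv, hsparse, hsol⟩ := exists_advice hs hm hρ rfl hr le_rfl
      (Nat.lt_two_pow_self (n := c)).le hdec hldec ⟨G, ident⟩ (hΔ G hG) (hD G hG) (hk G hG)
      (hsolvable G hG)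
    exact ⟨adv, hadv, hsparse, fun p => ⟨_, hsol, hA G ident p adv⟩⟩

end Schema

end LocalAdvice

theorem mainTheorem1 {In Out : Type} [Finite In] [Finite Out]
    (P : LocalAdvice.LCL In Out) (Δ : ℕ) (𝒢 : Set (LocalAdvice.LGraph In))
    (hΔ : ∀ G ∈ 𝒢, G.maxDeg ≤ Δ)
    (hgrowth : LocalAdvice.SubexpGrowth 𝒢)
    (hsolvable : ∀ G ∈ 𝒢, ∃ ℓ : ∀ u v : G.V, G.graph.Adj u v → Out, P.IsSolution G ℓ) :
    ∃ T : ℝ → ℕ, LocalAdvice.HasUniformSparseSchema 𝒢 P (fun ε _ => T ε) := by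
  classical
  have h : ∀ ε : ℝ, ∃ T : ℕ, 0 < ε → ∃ f : LocalAdvice.AdviceMap In,
      LocalAdvice.IsAdviceSchema 𝒢 P (fun _ => 1) (fun _ => T) f ∧
      LocalAdvice.IsUniformFixedLength 𝒢 f ∧ LocalAdvice.IsEpsSparse 𝒢 ε f := fun ε => by
    by_cases hε : 0 < ε
    · obtain ⟨T, hT⟩ := LocalAdvice.exists_sparse_schema hΔ hgrowth hsolvable hε
      exact ⟨T, fun _ => hT⟩
    · exact ⟨0, fun h => absurd h hε⟩
  choose T hT using h
  exact ⟨T, hT⟩
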